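/- Let $G_2$ be the simply connected nilpotent Lie group whose Lie algebra $\mathfrak g_2$ has dual basis $e^1,\dots,e^6$ with $de^1=de^2=de^3=de^4=0$, $de^5=e^{12}$, $de^6=e^{14}+e^{23}$ (where $e^{ij}=e^i\wedge e^j$), let $M_2=\Gamma\backslash G_2$ be an associated nilmanifold, and let $g=\sum_{i=1}^6 e^i\otimes e^i$. Tensors on $M_2$ are called invariant if they have constant coefficients with respect to $(e^i)$, i.e. if they are tensors on $\mathfrak g_2$. Let $\mathcal Z$ be the set of invariant $g$-orthogonal almost complex structures $J$ on $M_2$ that are positively oriented with respect to $e^{123456}$; each $J\in\mathcal Z$ is identified with its fundamental 2-form $\omega(X,Y)=g(JX,Y)$. Let $\nabla$ be the Levi-Civita connection of $g$, let $\mathcal W=\mathcal W_1\oplus\mathcal W_2\oplus\mathcal W_3\oplus\mathcal W_4$ be the Gray--Hervella decomposition of the space of tensors with the symmetries of $\nabla\omega$, and put $\mathcal Z_{34}=\{J\in\mathcal Z:\nabla\omega\in\mathcal W_3\oplus\mathcal W_4\}$ and $\mathcal Z_2=\{J\in\mathcal Z:\nabla\omega\in\mathcal W_2\}$. Let $\omega_0=e^{12}+e^{34}+e^{56}$,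 $\omega_1=e^{12}-e^{34}-e^{56}$, $\omega_2=-e^{12}+e^{34}-e^{56}$, $\omega_3=-e^{12}-e^{34}+e^{56}$, and $\varepsilon(\theta)=e^{56}+\cos\theta\,(e^{13}+e^{42})+\sin\theta\,(e^{14}+e^{23})$. Let $\mathcal E_{03}$ be the set of elements of $\mathcal Z$ of the form $e^{56}+\tau$ with $\tau\in\Lambda^2\langle e^1,e^2,e^3,e^4\rangle$, and let $S_{03}=\{\omega\in\mathcal E_{03}: g(\omega,\omega_0)=g(\omega,\omega_3)\}$ be its equatorial circle. Then: (1) $\mathcal Z_{34}$ is the set of invariant Hermitian structures on $(M_2,g)$, i.e. of those $J\in\mathcal Z$ whose Nijenhuis tensor vanishes, and it consists of exactly four distinct points, $$\mathcal Z_{34}=\{\omega_1,\ \omega_2,\ \varepsilon(\tfrac{2\pi}{3}),\ \varepsilon(-\tfrac{2\pi}{3})\},$$ of which exactly two, $\varepsilon(\tfrac{2\pi}3)$ and $\varepsilon(-\tfrac{2\pi}3)$, lie on $S_{03}$. (2) $\mathcal Z_2$ is the set of invariant symplectic structures compatible with $g$, i.e. of those $J\in\mathcal Z$ with $d\omega=0$,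 and it is the circle $$\mathcal S=\{-(Ae^3+Be^4)\wedge e^5+(Ae^1-Be^2)\wedge e^6+(Be^1+Ae^2)\wedge(-Be^3+Ae^4) : A,B\in\mathbb R,\ A^2+B^2=1\};$$ moreover $(A,B)\mapsto -(Ae^3+Be^4)\wedge e^5+(Ae^1-Be^2)\wedge e^6+(Be^1+Ae^2)\wedge(-Be^3+Ae^4)$ is a topological embedding of the unit circle into $\Lambda^2\mathfrak g_2^*$. -/

import Mathlib

open scoped Manifold

noncomputable section

/-! ### Invariant almost Hermitian geometry in dimension six

Invariant tensors on a six-dimensional Lie group (or on a quotient of it by a lattice) are tensors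
on its Lie algebra `L`.  A basis `e` of `L` is fixed; `e.coord i` is the dual coframe.
Indices run over `Fin 6`, so that `e.coord 0, …, e.coord 5` are the invariant 1-forms
`e¹, …, e⁶`.  Two-forms are represented by their bilinear evaluation maps. -/

namespace InvariantHermitian

section General

variable {L : Type*} [LieRing L] [LieAlgebra ℝ L]

/-- The invariant metric `g = ∑ eⁱ ⊗ eⁱ` for which the basis `e` is orthonormal. -/
def metric (e : Module.Basis (Fin 6) ℝ L) : LinearMap.BilinForm ℝ L :=
  ∑ i, LinearMap.BilinForm.linMulLin (e.coord i) (e.coord i)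

/-- The wedge product of two 1-forms: `(α ∧ β)(X, Y) = α X * β Y - α Y * β X`. -/
def wedge (α β : Module.Dual ℝ L) : LinearMap.BilinForm ℝ L :=
  LinearMap.BilinForm.linMulLin α β - LinearMap.BilinForm.linMulLin β α

/-- The inner product induced by `g` on 2-forms; the `eⁱ ∧ eʲ` with `i < j` are orthonormal. -/
def formInner (e : Module.Basis (Fin 6) ℝ L) (σ τ : LinearMap.BilinForm ℝ L) : ℝ :=
  ∑ i, ∑ j, if i < j then σ (e i) (e j) * τ (e i) (e j) else 0

/-- The fundamental 2-form `ω(X, Y) = g(JX, Y)`. -/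
def fundamentalForm (e : Module.Basis (Fin 6) ℝ L) (J : L →ₗ[ℝ] L) : LinearMap.BilinForm ℝ L :=
  (metric e).compLeft J

/-- `½ (ω ∧ ω)(X, Y, Z, T)`. -/
def halfSquare (ω : LinearMap.BilinForm ℝ L) (X Y Z T : L) : ℝ :=
  ω X Y * ω Z T - ω X Z * ω Y T + ω X T * ω Y Z

/-- The Pfaffian of a 2-form `ω` relative to `e`, expanded along the first row; it is the number
`p` with `ω ∧ ω ∧ ω = 6 p e¹ ∧ e² ∧ e³ ∧ e⁴ ∧ e⁵ ∧ e⁶`. -/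
def pfaffian (e : Module.Basis (Fin 6) ℝ L) (ω : LinearMap.BilinForm ℝ L) : ℝ :=
  ω (e 0) (e 1) * halfSquare ω (e 2) (e 3) (e 4) (e 5)
    - ω (e 0) (e 2) * halfSquare ω (e 1) (e 3) (e 4) (e 5)
    + ω (e 0) (e 3) * halfSquare ω (e 1) (e 2) (e 4) (e 5)
    - ω (e 0) (e 4) * halfSquare ω (e 1) (e 2) (e 3) (e 5)
    + ω (e 0) (e 5) * halfSquare ω (e 1) (e 2) (e 3) (e 4)

/-- The set `𝒵` of invariant orthogonal almost complex structures that are positively oriented,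
i.e. for which `ω ∧ ω ∧ ω` is a positive multiple of the volume form `e¹ ∧ ⋯ ∧ e⁶`. -/
def almostComplex (e : Module.Basis (Fin 6) ℝ L) : Set (L →ₗ[ℝ] L) :=
  {J | (∀ X, J (J X) = -X) ∧ (∀ X Y, metric e (J X) (J Y) = metric e X Y) ∧
    0 < pfaffian e (fundamentalForm e J)}

/-- The Levi-Civita connection of `g` on invariant vector fields, given by the Koszul formula
`2 g(∇_X Y, Z) = g([X, Y], Z) - g([Y, Z], X) + g([Z, X], Y)`. -/
def leviCivita (e : Module.Basis (Fin 6) ℝ L) : L →ₗ[ℝ] L →ₗ[ℝ] L :=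
  LinearMap.mk₂ ℝ
    (fun X Y => ∑ k, ((1 / 2 : ℝ) *
      (metric e ⁅X, Y⁆ (e k) - metric e ⁅Y, e k⁆ X + metric e ⁅e k, X⁆ Y)) • e k)
    (fun X X' Y => by
      rw [← Finset.sum_add_distrib]
      refine Finset.sum_congr rfl fun k _ => ?_
      rw [← add_smul]; congr 1
      simp only [add_lie, lie_add, map_add, LinearMap.add_apply]; ring)
    (fun c X Y => by
      rw [Finset.smul_sum]
      refine Finset.sum_congr rfl fun k _ => ?_
      rw [smul_smul]; congr 1
      simp only [smul_lie, lie_smul, map_smul, LinearMap.smul_apply, smul_eq_mul]; ring)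
    (fun X Y Y' => by
      rw [← Finset.sum_add_distrib]
      refine Finset.sum_congr rfl fun k _ => ?_
      rw [← add_smul]; congr 1
      simp only [add_lie, lie_add, map_add, LinearMap.add_apply]; ring)
    (fun c X Y => by
      rw [Finset.smul_sum]
      refine Finset.sum_congr rfl fun k _ => ?_
      rw [smul_smul]; congr 1
      simp only [smul_lie, lie_smul, map_smul, LinearMap.smul_apply, smul_eq_mul]; ring)

theorem metric_apply (e : Module.Basis (Fin 6) ℝ L) (X Y : L) :
    metric e X Y = ∑ i, e.coord i X * e.coord i Y := by
  simp [metric, LinearMap.BilinForm.linMulLin_apply]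

theorem metric_comm (e : Module.Basis (Fin 6) ℝ L) (X Y : L) :
    metric e X Y = metric e Y X := by
  simp only [metric_apply, mul_comm]

theorem metric_self_basis (e : Module.Basis (Fin 6) ℝ L) (X : L) (k : Fin 6) :
    metric e X (e k) = e.coord k X := by
  simp [metric_apply, Finsupp.single_apply]

/-- The Koszul formula. -/
theorem koszul (e : Module.Basis (Fin 6) ℝ L) (X Y Z : L) :
    2 * metric e (leviCivita e X Y) Z =
      metric e ⁅X, Y⁆ Z - metric e ⁅Y, Z⁆ X + metric e ⁅Z, X⁆ Y := by
  have h : ∀ k, 2 * metric e (leviCivita e X Y) (e k) =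
      metric e ⁅X, Y⁆ (e k) - metric e ⁅Y, e k⁆ X + metric e ⁅e k, X⁆ Y := by
    intro k
    rw [metric_self_basis]
    simp [leviCivita, LinearMap.mk₂_apply, Finsupp.single_apply]
  conv_lhs => rw [← e.sum_repr Z]
  conv_rhs => rw [← e.sum_repr Z]
  simp only [map_sum, map_smul, smul_eq_mul, LinearMap.sum_apply, LinearMap.smul_apply,
    lie_sum, sum_lie, lie_smul, smul_lie, Finset.mul_sum]
  rw [← Finset.sum_sub_distrib, ← Finset.sum_add_distrib]
  refine Finset.sum_congr rfl fun k _ => ?_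
  have := h k
  linear_combination (e.repr Z k) * this

/-- The connection is torsion-free. -/
theorem leviCivita_torsionFree (e : Module.Basis (Fin 6) ℝ L) (X Y : L) :
    leviCivita e X Y - leviCivita e Y X = ⁅X, Y⁆ := by
  refine e.ext_elem fun k => ?_
  have h1 := koszul e X Y (e k)
  have h2 := koszul e Y X (e k)
  have h3 : metric e ⁅Y, X⁆ (e k) = -metric e ⁅X, Y⁆ (e k) := by
    rw [← lie_skew Y X, map_neg, LinearMap.neg_apply]
  have h4 : metric e ⁅X, e k⁆ Y = -metric e ⁅e k, X⁆ Y := by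
    rw [← lie_skew (X) (e k), map_neg, LinearMap.neg_apply]
  have h5 : metric e ⁅Y, e k⁆ X = -metric e ⁅e k, Y⁆ X := by
    rw [← lie_skew Y (e k), map_neg, LinearMap.neg_apply]
  rw [metric_self_basis, metric_self_basis] at h1 h2 h3
  simp only [Module.Basis.coord_apply] at h1 h2 h3
  simp only [map_sub, Finsupp.sub_apply]
  linarith

/-- The connection is compatible with the metric. -/
theorem leviCivita_metric (e : Module.Basis (Fin 6) ℝ L) (X Y Z : L) :
    metric e (leviCivita e X Y) Z + metric e Y (leviCivita e X Z) = 0 := by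
  have h1 := koszul e X Y Z
  have h2 := koszul e X Z Y
  rw [metric_comm e Y]
  have h3 : metric e ⁅Z, X⁆ Y = -metric e ⁅X, Z⁆ Y := by
    rw [← lie_skew, map_neg, LinearMap.neg_apply]
  have h4 : metric e ⁅Y, X⁆ Z = -metric e ⁅X, Y⁆ Z := by
    rw [← lie_skew, map_neg, LinearMap.neg_apply]
  have h5 : metric e ⁅Y, Z⁆ X = -metric e ⁅Z, Y⁆ X := by
    rw [← lie_skew, map_neg, LinearMap.neg_apply]
  linarith

/-- The covariant derivative of an invariant 2-form:
`(∇ω)(X; Y, Z) = (∇_X ω)(Y, Z) = -ω(∇_X Y, Z) - ω(Y, ∇_X Z)`. -/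
def nablaForm (e : Module.Basis (Fin 6) ℝ L) (ω : LinearMap.BilinForm ℝ L) :
    L →ₗ[ℝ] L →ₗ[ℝ] L →ₗ[ℝ] ℝ where
  toFun X := -(ω.compLeft (leviCivita e X)) - ω.compRight (leviCivita e X)
  map_add' X X' := by
    ext Y Z
    simp only [LinearMap.sub_apply, LinearMap.neg_apply, LinearMap.add_apply, map_add,
      LinearMap.BilinForm.compLeft_apply, LinearMap.BilinForm.compRight_apply]
    ring
  map_smul' c X := by
    ext Y Z
    simp only [LinearMap.sub_apply, LinearMap.neg_apply, LinearMap.smul_apply, map_smul,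
      LinearMap.BilinForm.compLeft_apply, LinearMap.BilinForm.compRight_apply, smul_eq_mul,
      RingHom.id_apply]
    ring

/-- The Gray–Hervella space `𝒲` of tensors with the symmetries of `∇ω`:
`a(X, Y, Z) = -a(X, Z, Y) = -a(X, JY, JZ)`. -/
def ghSpace (J : L →ₗ[ℝ] L) : Submodule ℝ (L →ₗ[ℝ] L →ₗ[ℝ] L →ₗ[ℝ] ℝ) where
  carrier := {a | ∀ X Y Z, a X Y Z = -a X Z Y ∧ a X Y Z = -a X (J Y) (J Z)}
  add_mem' {a b} ha hb X Y Z := by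
    have h1 := ha X Y Z
    have h2 := hb X Y Z
    simp only [LinearMap.add_apply]
    exact ⟨by linarith [h1.1, h2.1], by linarith [h1.2, h2.2]⟩
  zero_mem' X Y Z := by simp
  smul_mem' c a ha X Y Z := by
    have h1 := ha X Y Z
    simp only [LinearMap.smul_apply, smul_eq_mul]
    exact ⟨by linear_combination c * h1.1, by linear_combination c * h1.2⟩

/-- The trace `∑ᵢ a(eᵢ, eᵢ, Z)` over an orthonormal basis. -/
def tensorTrace (e : Module.Basis (Fin 6) ℝ L) (a : L →ₗ[ℝ] L →ₗ[ℝ] L →ₗ[ℝ] ℝ) (Z : L) : ℝ :=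
  ∑ i, a (e i) (e i) Z

theorem tensorTrace_add (e : Module.Basis (Fin 6) ℝ L) (a b : L →ₗ[ℝ] L →ₗ[ℝ] L →ₗ[ℝ] ℝ)
    (Z : L) : tensorTrace e (a + b) Z = tensorTrace e a Z + tensorTrace e b Z := by
  simp [tensorTrace, Finset.sum_add_distrib]

theorem tensorTrace_smul (e : Module.Basis (Fin 6) ℝ L) (c : ℝ)
    (a : L →ₗ[ℝ] L →ₗ[ℝ] L →ₗ[ℝ] ℝ) (Z : L) :
    tensorTrace e (c • a) Z = c * tensorTrace e a Z := by
  simp [tensorTrace, Finset.mul_sum]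

/-- The Gray–Hervella component `𝒲₂`: tensors in `𝒲` with vanishing cyclic sum. -/
def ghW2 (J : L →ₗ[ℝ] L) : Submodule ℝ (L →ₗ[ℝ] L →ₗ[ℝ] L →ₗ[ℝ] ℝ) :=
  ghSpace J ⊓
  { carrier := {a | ∀ X Y Z, a X Y Z + a Y Z X + a Z X Y = 0}
    add_mem' := fun {a b} ha hb X Y Z => by
      have h1 := ha X Y Z
      have h2 := hb X Y Z
      simp only [LinearMap.add_apply]
      linarith
    zero_mem' := fun X Y Z => by simp
    smul_mem' := fun c a ha X Y Z => by
      have h1 := ha X Y Z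
      simp only [LinearMap.smul_apply, smul_eq_mul]
      linear_combination c * h1 }

/-- The Gray–Hervella component `𝒲₃`: trace-free tensors in `𝒲` with
`a(X, Y, Z) = a(JX, JY, Z)`. -/
def ghW3 (e : Module.Basis (Fin 6) ℝ L) (J : L →ₗ[ℝ] L) :
    Submodule ℝ (L →ₗ[ℝ] L →ₗ[ℝ] L →ₗ[ℝ] ℝ) :=
  ghSpace J ⊓
  { carrier := {a | (∀ X Y Z, a X Y Z = a (J X) (J Y) Z) ∧ ∀ Z, tensorTrace e a Z = 0}
    add_mem' := fun {a b} ha hb => by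
      refine ⟨fun X Y Z => ?_, fun Z => ?_⟩
      · have h1 := ha.1 X Y Z
        have h2 := hb.1 X Y Z
        simp only [LinearMap.add_apply]
        linarith
      · rw [tensorTrace_add, ha.2 Z, hb.2 Z, add_zero]
    zero_mem' := ⟨fun X Y Z => by simp, fun Z => by simp [tensorTrace]⟩
    smul_mem' := fun c a ha => by
      refine ⟨fun X Y Z => ?_, fun Z => ?_⟩
      · have h1 := ha.1 X Y Z
        simp only [LinearMap.smul_apply, smul_eq_mul]
        linear_combination c * h1
      · rw [tensorTrace_smul, ha.2 Z, mul_zero] }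

/-- The Gray–Hervella component `𝒲₄`: the tensors in `𝒲` that are determined by their trace `t`,
`a(X, Y, Z) = (1 / 2(n - 1)) (g(X, Y) t(Z) - g(X, Z) t(Y) - g(X, JY) t(JZ) + g(X, JZ) t(JY))`
in real dimension `2n = 6`. -/
def ghW4 (e : Module.Basis (Fin 6) ℝ L) (J : L →ₗ[ℝ] L) :
    Submodule ℝ (L →ₗ[ℝ] L →ₗ[ℝ] L →ₗ[ℝ] ℝ) :=
  ghSpace J ⊓
  { carrier := {a | ∀ X Y Z, a X Y Z = (1 / 4 : ℝ) *
      (metric e X Y * tensorTrace e a Z - metric e X Z * tensorTrace e a Y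
        - metric e X (J Y) * tensorTrace e a (J Z) + metric e X (J Z) * tensorTrace e a (J Y))}
    add_mem' := fun {a b} ha hb X Y Z => by
      have h1 := ha X Y Z
      have h2 := hb X Y Z
      simp only [LinearMap.add_apply, tensorTrace_add]
      linarith
    zero_mem' := fun X Y Z => by simp [tensorTrace]
    smul_mem' := fun c a ha X Y Z => by
      have h1 := ha X Y Z
      simp only [LinearMap.smul_apply, smul_eq_mul, tensorTrace_smul]
      linear_combination c * h1 }

/-- The class `𝒵₃₄ = {J ∈ 𝒵 : ∇ω ∈ 𝒲₃ ⊕ 𝒲₄}`. -/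
def classZ34 (e : Module.Basis (Fin 6) ℝ L) : Set (L →ₗ[ℝ] L) :=
  {J | J ∈ almostComplex e ∧ nablaForm e (fundamentalForm e J) ∈ ghW3 e J ⊔ ghW4 e J}

/-- The class `𝒵₂ = {J ∈ 𝒵 : ∇ω ∈ 𝒲₂}`. -/
def classZ2 (e : Module.Basis (Fin 6) ℝ L) : Set (L →ₗ[ℝ] L) :=
  {J | J ∈ almostComplex e ∧ nablaForm e (fundamentalForm e J) ∈ ghW2 J}

/-- The Nijenhuis tensor of an invariant almost complex structure. -/
def nijenhuis (J : L →ₗ[ℝ] L) (X Y : L) : L :=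
  ⁅J X, J Y⁆ - ⁅X, Y⁆ - J ⁅J X, Y⁆ - J ⁅X, J Y⁆

/-- The exterior derivative of an invariant 2-form, evaluated on invariant vector fields. -/
def extDerivForm (ω : LinearMap.BilinForm ℝ L) (X Y Z : L) : ℝ :=
  -ω ⁅X, Y⁆ Z + ω ⁅X, Z⁆ Y - ω ⁅Y, Z⁆ X

/-- The invariant Hermitian structures: the integrable elements of `𝒵`. -/
def hermitianStructures (e : Module.Basis (Fin 6) ℝ L) : Set (L →ₗ[ℝ] L) :=
  {J | J ∈ almostComplex e ∧ ∀ X Y, nijenhuis J X Y = 0}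

/-- The invariant symplectic structures compatible with `g`: the elements of `𝒵` whose fundamental
2-form is closed. -/
def symplecticStructures (e : Module.Basis (Fin 6) ℝ L) : Set (L →ₗ[ℝ] L) :=
  {J | J ∈ almostComplex e ∧ ∀ X Y Z, extDerivForm (fundamentalForm e J) X Y Z = 0}

/-- The 2-form `eⁱʲ = eⁱ ∧ eʲ` (indices in `Fin 6`, so `form e 0 1` is `e¹ ∧ e²`). -/
def form (e : Module.Basis (Fin 6) ℝ L) (i j : Fin 6) : LinearMap.BilinForm ℝ L :=
  wedge (e.coord i) (e.coord j)

/-- `ω₀ = e¹² + e³⁴ + e⁵⁶`. -/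
def omega0 (e : Module.Basis (Fin 6) ℝ L) : LinearMap.BilinForm ℝ L :=
  form e 0 1 + form e 2 3 + form e 4 5

/-- `ω₁ = e¹² - e³⁴ - e⁵⁶`. -/
def omega1 (e : Module.Basis (Fin 6) ℝ L) : LinearMap.BilinForm ℝ L :=
  form e 0 1 - form e 2 3 - form e 4 5

/-- `ω₂ = -e¹² + e³⁴ - e⁵⁶`. -/
def omega2 (e : Module.Basis (Fin 6) ℝ L) : LinearMap.BilinForm ℝ L :=
  -form e 0 1 + form e 2 3 - form e 4 5

/-- `ω₃ = -e¹² - e³⁴ + e⁵⁶`. -/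
def omega3 (e : Module.Basis (Fin 6) ℝ L) : LinearMap.BilinForm ℝ L :=
  -form e 0 1 - form e 2 3 + form e 4 5

/-- The space `Λ²𝔻` of 2-forms on `𝔻 = ⟨e¹, e², e³, e⁴⟩ = ⟨e⁵, e⁶⟩^⊥`. -/
def lambdaTwoD (e : Module.Basis (Fin 6) ℝ L) : Submodule ℝ (LinearMap.BilinForm ℝ L) :=
  Submodule.span ℝ {τ | ∃ i j : Fin 6, i < 4 ∧ j < 4 ∧ τ = form e i j}

/-- The edge `ℰ₀₃`, i.e. the projective line of all fundamental forms `e⁵⁶ + τ` of elements of `𝒵`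
with `τ ∈ Λ²⟨e⁵, e⁶⟩^⊥`; it contains `ω₀` and `ω₃`. -/
def edge03 (e : Module.Basis (Fin 6) ℝ L) : Set (LinearMap.BilinForm ℝ L) :=
  {ω | ω ∈ fundamentalForm e '' almostComplex e ∧ ∃ τ ∈ lambdaTwoD e, ω = form e 4 5 + τ}

/-- The equatorial circle `S₀₃` of the edge `ℰ₀₃`: its points equidistant from `ω₀` and `ω₃`. -/
def equator03 (e : Module.Basis (Fin 6) ℝ L) : Set (LinearMap.BilinForm ℝ L) :=
  {ω | ω ∈ edge03 e ∧ formInner e ω (omega0 e) = formInner e ω (omega3 e)}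

/-- `ε(θ) = e⁵⁶ + cos θ (e¹³ + e⁴²) + sin θ (e¹⁴ + e²³)`. -/
def epsilonForm (e : Module.Basis (Fin 6) ℝ L) (θ : ℝ) : LinearMap.BilinForm ℝ L :=
  form e 4 5 + Real.cos θ • (form e 0 2 + form e 3 1)
    + Real.sin θ • (form e 0 3 + form e 1 2)

/-- `-(A e³ + B e⁴) ∧ e⁵ + (A e¹ - B e²) ∧ e⁶ + (B e¹ + A e²) ∧ (-B e³ + A e⁴)`. -/
def circleForm (e : Module.Basis (Fin 6) ℝ L) (A B : ℝ) : LinearMap.BilinForm ℝ L :=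
  -wedge (A • e.coord 2 + B • e.coord 3) (e.coord 4)
    + wedge (A • e.coord 0 - B • e.coord 1) (e.coord 5)
    + wedge (B • e.coord 0 + A • e.coord 1) (-(B • e.coord 2) + A • e.coord 3)

/-- The set `𝒮` of all `circleForm e A B` with `A² + B² = 1`. -/
def circleS (e : Module.Basis (Fin 6) ℝ L) : Set (LinearMap.BilinForm ℝ L) :=
  {ω | ∃ A B : ℝ, A ^ 2 + B ^ 2 = 1 ∧ ω = circleForm e A B}

end General

/-! ### The nilpotent Lie group `G₂` with `de⁵ = e¹², de⁶ = e¹⁴ + e²³` -/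

/-- The underlying manifold `ℝ⁶` of the simply connected nilpotent Lie group `G₂`. -/
def G2 : Type := Fin 6 → ℝ

instance : TopologicalSpace G2 := inferInstanceAs (TopologicalSpace (Fin 6 → ℝ))

instance : ChartedSpace (Fin 6 → ℝ) G2 := inferInstanceAs (ChartedSpace (Fin 6 → ℝ) (Fin 6 → ℝ))

/-- The group law of `G₂`, for which the coframe `dx₁, dx₂, dx₃, dx₄, dx₅ + x₁ dx₂,
dx₆ + x₁ dx₄ + x₂ dx₃` is left-invariant. -/
def G2.mul (x y : Fin 6 → ℝ) : Fin 6 → ℝ :=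
  ![x 0 + y 0, x 1 + y 1, x 2 + y 2, x 3 + y 3, x 4 + y 4 - x 0 * y 1,
    x 5 + y 5 - x 0 * y 3 - x 1 * y 2]

/-- The inverse in `G₂`. -/
def G2.inv (x : Fin 6 → ℝ) : Fin 6 → ℝ :=
  ![-x 0, -x 1, -x 2, -x 3, -x 4 - x 0 * x 1, -x 5 - x 0 * x 3 - x 1 * x 2]

instance : Group G2 where
  mul := G2.mul
  one := (0 : Fin 6 → ℝ)
  inv := G2.inv
  mul_assoc x y z := by
    change G2.mul (G2.mul x y) z = G2.mul x (G2.mul y z)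
    funext i
    fin_cases i <;> simp [G2.mul] <;> ring
  one_mul x := by
    change G2.mul 0 x = x
    funext i
    fin_cases i <;> simp [G2.mul]
  mul_one x := by
    change G2.mul x 0 = x
    funext i
    fin_cases i <;> simp [G2.mul]
  inv_mul_cancel x := by
    change G2.mul (G2.inv x) x = 0
    funext i
    fin_cases i <;> simp [G2.mul, G2.inv] <;> ring

instance (n : WithTop ℕ∞) : IsManifold 𝓘(ℝ, Fin 6 → ℝ) n G2 :=
  inferInstanceAs (IsManifold 𝓘(ℝ, Fin 6 → ℝ) n (Fin 6 → ℝ))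

theorem G2.contDiff_mul (n : WithTop ℕ∞) :
    ContDiff ℝ n (fun p : (Fin 6 → ℝ) × (Fin 6 → ℝ) => G2.mul p.1 p.2) := by
  rw [contDiff_pi]
  intro i
  fin_cases i <;> simp [G2.mul] <;> fun_prop

theorem G2.contDiff_inv (n : WithTop ℕ∞) : ContDiff ℝ n G2.inv := by
  rw [contDiff_pi]
  intro i
  fin_cases i <;> simp [G2.inv] <;> fun_prop

instance (n : WithTop ℕ∞) : LieGroup 𝓘(ℝ, Fin 6 → ℝ) n G2 where
  contMDiff_mul := by
    have h := (G2.contDiff_mul n).contMDiff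
    rw [modelWithCornersSelf_prod, ← chartedSpaceSelf_prod] at h
    exact h
  contMDiff_inv := (G2.contDiff_inv n).contMDiff

/-- The Lie algebra `𝔤₂` of `G₂`, as defined in Mathlib through left-invariant vector fields. -/
abbrev g2 : Type := GroupLieAlgebra 𝓘(ℝ, Fin 6 → ℝ) G2

/-- The basis of `𝔤₂ = T₁G₂ = ℝ⁶` dual to the coframe `(e¹, …, e⁶)`. -/
def g2Basis : Module.Basis (Fin 6) ℝ g2 := Pi.basisFun ℝ (Fin 6)

/-- Left translation in coordinates has the expected derivative at the identity. -/
theorem G2.fderiv_mul_left (x v : Fin 6 → ℝ) :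
    fderiv ℝ (G2.mul x) 0 v =
      ![v 0, v 1, v 2, v 3, v 4 - x 0 * v 1, v 5 - x 0 * v 3 - x 1 * v 2] := by
  have h : HasFDerivAt (G2.mul x) (ContinuousLinearMap.pi (fun i : Fin 6 =>
      (![ContinuousLinearMap.proj 0, ContinuousLinearMap.proj 1, ContinuousLinearMap.proj 2,
        ContinuousLinearMap.proj 3,
        ContinuousLinearMap.proj 4 - x 0 • ContinuousLinearMap.proj 1,
        ContinuousLinearMap.proj 5 - x 0 • ContinuousLinearMap.proj 3
          - x 1 • ContinuousLinearMap.proj 2] i : (Fin 6 → ℝ) →L[ℝ] ℝ))) 0 := by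
    rw [hasFDerivAt_pi]
    intro i
    have p : ∀ j : Fin 6, HasFDerivAt (fun y : Fin 6 → ℝ => y j)
        (ContinuousLinearMap.proj j : (Fin 6 → ℝ) →L[ℝ] ℝ) 0 := fun j => hasFDerivAt_apply j 0
    fin_cases i
    · exact (p 0).const_add (x 0)
    · exact (p 1).const_add (x 1)
    · exact (p 2).const_add (x 2)
    · exact (p 3).const_add (x 3)
    · exact ((p 4).const_add (x 4)).sub ((p 1).const_mul (x 0))
    · exact (((p 5).const_add (x 5)).sub ((p 3).const_mul (x 0))).sub ((p 2).const_mul (x 1))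
  rw [h.fderiv]
  funext i
  fin_cases i <;> simp

/-- The left-invariant vector fields in coordinates. -/
def G2.field (v x : Fin 6 → ℝ) : Fin 6 → ℝ :=
  ![v 0, v 1, v 2, v 3, v 4 - x 0 * v 1, v 5 - x 0 * v 3 - x 1 * v 2]

theorem G2.hasFDerivAt_field (v x : Fin 6 → ℝ) :
    HasFDerivAt (G2.field v) (ContinuousLinearMap.pi (fun i : Fin 6 =>
      (![0, 0, 0, 0, -(v 1 • ContinuousLinearMap.proj 0),
        -(v 3 • ContinuousLinearMap.proj 0) - v 2 • ContinuousLinearMap.proj 1] i :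
          (Fin 6 → ℝ) →L[ℝ] ℝ))) x := by
  rw [hasFDerivAt_pi]
  intro i
  have p : ∀ j : Fin 6, HasFDerivAt (fun y : Fin 6 → ℝ => y j)
      (ContinuousLinearMap.proj j : (Fin 6 → ℝ) →L[ℝ] ℝ) x := fun j => hasFDerivAt_apply j x
  fin_cases i
  · exact hasFDerivAt_const (v 0) x
  · exact hasFDerivAt_const (v 1) x
  · exact hasFDerivAt_const (v 2) x
  · exact hasFDerivAt_const (v 3) x
  · exact ((p 0).mul_const (v 1)).const_sub (v 4)
  · exact (((p 0).mul_const (v 3)).const_sub (v 5)).sub ((p 1).mul_const (v 2))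

theorem G2.mulInvariantVectorField_eq (v : g2) :
    (mulInvariantVectorField v : (x : G2) → TangentSpace 𝓘(ℝ, Fin 6 → ℝ) x) =
      (G2.field v : (Fin 6 → ℝ) → (Fin 6 → ℝ)) := by
  funext x
  have h : mulInvariantVectorField v x = mfderiv 𝓘(ℝ, Fin 6 → ℝ) 𝓘(ℝ, Fin 6 → ℝ)
      (M := Fin 6 → ℝ) (M' := Fin 6 → ℝ) (G2.mul x) 0 v := rfl
  rw [h, mfderiv_eq_fderiv]
  exact G2.fderiv_mul_left x v

theorem G2.lieBracket_field (v w : Fin 6 → ℝ) :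
    VectorField.lieBracket ℝ (G2.field v) (G2.field w) 0 =
      ![0, 0, 0, 0, v 1 * w 0 - v 0 * w 1,
        v 3 * w 0 - v 0 * w 3 + v 2 * w 1 - v 1 * w 2] := by
  rw [VectorField.lieBracket, (G2.hasFDerivAt_field v 0).fderiv,
    (G2.hasFDerivAt_field w 0).fderiv]
  funext i
  fin_cases i <;> simp [G2.field] <;> ring

theorem g2_bracket (v w : g2) :
    ⁅v, w⁆ = (![0, 0, 0, 0, v 1 * w 0 - v 0 * w 1,
      v 3 * w 0 - v 0 * w 3 + v 2 * w 1 - v 1 * w 2] : Fin 6 → ℝ) := by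
  rw [GroupLieAlgebra.bracket_def, G2.mulInvariantVectorField_eq, G2.mulInvariantVectorField_eq]
  refine Eq.trans ?_ (G2.lieBracket_field v w)
  have h : ∀ V W : (x : Fin 6 → ℝ) → TangentSpace 𝓘(ℝ, Fin 6 → ℝ) x,
      VectorField.mlieBracket 𝓘(ℝ, Fin 6 → ℝ) V W = VectorField.lieBracket ℝ V W := by
    intro V W
    rw [← VectorField.mlieBracketWithin_univ,
      VectorField.mlieBracketWithin_eq_lieBracketWithin]
    exact VectorField.lieBracketWithin_univ
  exact congrFun (h (G2.field v) (G2.field w)) (0 : Fin 6 → ℝ)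

/-- The structure equations `de¹ = de² = de³ = de⁴ = 0`, `de⁵ = e¹²`, `de⁶ = e¹⁴ + e²³` of `𝔤₂`,
where `dα(X, Y) = -α([X, Y])`. -/
theorem g2_structure (X Y : g2) :
    (∀ i : Fin 6, i < 4 → -g2Basis.coord i ⁅X, Y⁆ = 0) ∧
    -g2Basis.coord 4 ⁅X, Y⁆ = form g2Basis 0 1 X Y ∧
    -g2Basis.coord 5 ⁅X, Y⁆ = (form g2Basis 0 3 + form g2Basis 1 2) X Y := by
  have b : ∀ i : Fin 6, g2Basis.coord i ⁅X, Y⁆ =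
      (![0, 0, 0, 0,
        g2Basis.coord 1 X * g2Basis.coord 0 Y - g2Basis.coord 0 X * g2Basis.coord 1 Y,
        g2Basis.coord 3 X * g2Basis.coord 0 Y - g2Basis.coord 0 X * g2Basis.coord 3 Y
          + g2Basis.coord 2 X * g2Basis.coord 1 Y
          - g2Basis.coord 1 X * g2Basis.coord 2 Y] : Fin 6 → ℝ) i :=
    fun i => congrFun (g2_bracket X Y) i
  refine ⟨fun i hi => ?_, ?_, ?_⟩
  · rw [b]
    fin_cases i <;> first | exact absurd hi (by decide) | simp
  · rw [b]
    simp only [form, wedge, LinearMap.sub_apply, LinearMap.BilinForm.linMulLin_apply]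
    simp
  · rw [b]
    simp only [form, wedge, LinearMap.sub_apply, LinearMap.add_apply,
      LinearMap.BilinForm.linMulLin_apply]
    simp
    ring

end InvariantHermitian

end

open InvariantHermitian

noncomputable section

namespace InvariantHermitian

/-! ### Gray–Hervella classes, integrability and closedness -/

section General

variable {L : Type*} [LieRing L] [LieAlgebra ℝ L]

/-! The Gray–Hervella conditions are first reduced to classical ones, for any six-dimensional Lie
algebra with an orthonormal basis. The tensor `∇ω` always lies in `𝒲`. The sum `𝒲₃ ⊕ 𝒲₄` is cut out
of `𝒲` by `a(X, Y, Z) = a(JX, JY, Z)`, because the trace part can be split off explicitly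
(`mem_ghW3_sup_ghW4_iff`). For `∇ω` this identity is equivalent to integrability
(`nijenhuis_eq_zero_iff`). The condition defining `𝒲₂` is the vanishing of a cyclic sum, which for
`∇ω` is `dω` (`cyclicSum_nablaForm`).

What remains is algebra for the skew coefficient matrix `M` of `ω`, with `M² = -1` and positive
Pfaffian.

Integrable case: the Nijenhuis tensor paired with the central vector `e₅` forces `J` to preserve the
centre `⟨e₅, e₆⟩` (`center_invariant`). Hence `ω = ±e⁵⁶ + τ`, and the orientation makes `τ` a unit
self-dual (sign `+`) or anti-self-dual (sign `-`) form on `⟨e₁, …, e₄⟩` (`selfDual_of_sq`). A few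
components of `N` then leave two points for each sign (`hermitian_coefficients`).

Symplectic case: closedness is linear in `M` (`closed_coefficients`). It turns `Je₅` and `Je₆` into
vectors of `⟨e₁, …, e₄⟩` governed by one point of the unit circle; `J` acts on the orthogonal plane
as a rotation whose sense the orientation decides (`symplectic_coefficients`).

Conversely, each listed matrix is checked directly, and `exists_almostComplex` turns it into an
element of `𝒵`. -/

theorem metric_ext {e : Module.Basis (Fin 6) ℝ L} {X Y : L}
    (h : ∀ Z, metric e X Z = metric e Y Z) : X = Y :=
  e.ext_elem fun k => by simpa [metric_self_basis] using h (e k)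

theorem metric_skew {e : Module.Basis (Fin 6) ℝ L} {J : L →ₗ[ℝ] L} (hJ : J ∈ almostComplex e)
    (X Y : L) : metric e (J X) Y = -metric e X (J Y) := by
  rw [← hJ.2.1 X (J Y), hJ.1 Y, map_neg, neg_neg]

/-- `∇ω` is the covariant derivative of `J` with its last index lowered. -/
theorem nablaForm_apply (e : Module.Basis (Fin 6) ℝ L) (J : L →ₗ[ℝ] L) (X Y Z : L) :
    nablaForm e (fundamentalForm e J) X Y Z =
      metric e (leviCivita e X (J Y) - J (leviCivita e X Y)) Z := by
  have h := leviCivita_metric e X (J Y) Z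
  have h1 : nablaForm e (fundamentalForm e J) X Y Z =
    -metric e (J (leviCivita e X Y)) Z - metric e (J Y) (leviCivita e X Z) := rfl
  rw [h1, map_sub, LinearMap.sub_apply]
  linarith

/-- Since `∇` is metric, `∇_X J` is skew and anticommutes with `J`. Membership in `𝒲` is thus
automatic, and only the extra condition defining each class has content. -/
theorem nablaForm_mem_ghSpace {e : Module.Basis (Fin 6) ℝ L} {J : L →ₗ[ℝ] L}
    (hJ : J ∈ almostComplex e) : nablaForm e (fundamentalForm e J) ∈ ghSpace J := by
  intro X Y Z
  have h1 := leviCivita_metric e X (J Y) Z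
  have h2 := leviCivita_metric e X Y (J Z)
  have h3 := metric_skew hJ (leviCivita e X Y) Z
  have h4 := metric_skew hJ (leviCivita e X Z) Y
  have h5 := hJ.2.1 (leviCivita e X (J Y)) Z
  have c1 := metric_comm e Y (leviCivita e X (J Z))
  have c2 := metric_comm e (leviCivita e X Z) (J Y)
  simp only [nablaForm_apply, map_sub, LinearMap.sub_apply, hJ.1, map_neg, LinearMap.neg_apply]
  constructor <;> linarith

/-- The Nijenhuis tensor in terms of `∇ω`. -/
theorem metric_nijenhuis {e : Module.Basis (Fin 6) ℝ L} {J : L →ₗ[ℝ] L}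
    (hJ : J ∈ almostComplex e) (X Y Z : L) :
    metric e (nijenhuis J X Y) Z =
      (nablaForm e (fundamentalForm e J) (J X) Y Z + nablaForm e (fundamentalForm e J) X Y (J Z))
      - (nablaForm e (fundamentalForm e J) (J Y) X Z
        + nablaForm e (fundamentalForm e J) Y X (J Z)) := by
  have s := metric_skew hJ
  -- Every bracket becomes a difference of covariant derivatives; the eight resulting terms pair up
  -- into four values of `∇J`.
  simp only [nijenhuis, nablaForm_apply, ← leviCivita_torsionFree e, map_sub,
    LinearMap.sub_apply, s, hJ.1, map_neg]
  ring

theorem ghSpace_move {J : L →ₗ[ℝ] L} (hJ : ∀ X, J (J X) = -X)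
    {a : L →ₗ[ℝ] L →ₗ[ℝ] L →ₗ[ℝ] ℝ} (ha : a ∈ ghSpace J) (X Y Z : L) :
    a X Y (J Z) = a X (J Y) Z := by
  have h := (ha X Y (J Z)).2
  rw [hJ, map_neg, neg_neg] at h
  exact h

/-- `J` is integrable if and only if `∇ω(X, Y, Z) = ∇ω(JX, JY, Z)`. -/
theorem nijenhuis_eq_zero_iff {e : Module.Basis (Fin 6) ℝ L} {J : L →ₗ[ℝ] L}
    (hJ : J ∈ almostComplex e) :
    (∀ X Y, nijenhuis J X Y = 0) ↔ ∀ X Y Z, nablaForm e (fundamentalForm e J) X Y Z =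
      nablaForm e (fundamentalForm e J) (J X) (J Y) Z := by
  have hW := nablaForm_mem_ghSpace hJ
  have hN := metric_nijenhuis hJ
  have mv := ghSpace_move hJ.1 hW
  set a := nablaForm e (fundamentalForm e J) with ha
  constructor
  · intro h
    have sym : ∀ X Y Z, a (J X) Y Z + a X (J Y) Z = a (J Y) X Z + a Y (J X) Z := by
      intro X Y Z
      have := hN X Y Z
      rw [h, map_zero, LinearMap.zero_apply, mv, mv] at this
      linarith
    have skew : ∀ X Y Z, a (J X) Y Z + a X (J Y) Z = -(a (J X) Z Y + a X (J Z) Y) := by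
      intro X Y Z
      rw [(hW (J X) Y Z).1, (hW X (J Y) Z).1, mv]
      ring
    intro X Y Z
    have key : ∀ X Y Z, a (J X) Y Z + a X (J Y) Z = 0 := by
      intro X Y Z
      -- A trilinear form symmetric in its first two arguments and skew in its last two is zero: six
      -- alternate swaps return it to itself with the opposite sign.
      linarith [sym X Y Z, skew Y X Z, sym Y Z X, skew Z Y X, sym Z X Y, skew X Z Y]
    have := key (J X) Y Z
    rw [hJ.1, map_neg, LinearMap.neg_apply, LinearMap.neg_apply] at this
    linarith
  · intro h X Y
    refine metric_ext (e := e) fun Z => ?_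
    rw [hN, map_zero, LinearMap.zero_apply, mv, mv]
    have h1 := h (J X) Y Z
    have h2 := h (J Y) X Z
    rw [hJ.1, map_neg, LinearMap.neg_apply, LinearMap.neg_apply] at h1 h2
    linarith

/-- The tensor in `𝒲₄` with a prescribed trace. -/
def traceTensor (e : Module.Basis (Fin 6) ℝ L) (J : L →ₗ[ℝ] L) (t : Module.Dual ℝ L) :
    L →ₗ[ℝ] L →ₗ[ℝ] L →ₗ[ℝ] ℝ :=
  LinearMap.mk₂ ℝ (fun X Y => (1 / 4 : ℝ) •
      (metric e X Y • t - t Y • metric e X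
        - metric e X (J Y) • t.comp J + t (J Y) • (metric e X).comp J))
    (fun X X' Y => by
      ext Z
      simp only [map_add, LinearMap.add_apply, LinearMap.sub_apply, LinearMap.smul_apply,
        LinearMap.comp_apply, smul_eq_mul]
      ring)
    (fun c X Y => by
      ext Z
      simp only [map_smul, LinearMap.add_apply, LinearMap.sub_apply, LinearMap.smul_apply,
        LinearMap.comp_apply, smul_eq_mul]
      ring)
    (fun X Y Y' => by
      ext Z
      simp only [map_add, LinearMap.add_apply, LinearMap.sub_apply, LinearMap.smul_apply,
        LinearMap.comp_apply, smul_eq_mul]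
      ring)
    (fun c X Y => by
      ext Z
      simp only [map_smul, LinearMap.add_apply, LinearMap.sub_apply, LinearMap.smul_apply,
        LinearMap.comp_apply, smul_eq_mul]
      ring)

theorem traceTensor_apply (e : Module.Basis (Fin 6) ℝ L) (J : L →ₗ[ℝ] L) (t : Module.Dual ℝ L)
    (X Y Z : L) : traceTensor e J t X Y Z = (1 / 4 : ℝ) *
      (metric e X Y * t Z - metric e X Z * t Y - metric e X (J Y) * t (J Z)
        + metric e X (J Z) * t (J Y)) := by
  simp only [traceTensor, LinearMap.mk₂_apply, LinearMap.add_apply, LinearMap.sub_apply,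
    LinearMap.smul_apply, LinearMap.comp_apply, smul_eq_mul]
  ring

theorem metric_apply_J_self {e : Module.Basis (Fin 6) ℝ L} {J : L →ₗ[ℝ] L}
    (hJ : J ∈ almostComplex e) (X : L) : metric e X (J X) = 0 := by
  have h := metric_skew hJ X X
  rw [metric_comm] at h
  linarith

theorem sum_metric_basis_mul (e : Module.Basis (Fin 6) ℝ L) (t : Module.Dual ℝ L) (Z : L) :
    ∑ i, metric e (e i) Z * t (e i) = t Z := by
  conv_rhs => rw [← e.sum_repr Z]
  simp only [map_sum, map_smul, smul_eq_mul, metric_comm e _ Z, metric_self_basis,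
    Module.Basis.coord_apply]

/-- The four terms contribute `6t`, `-t`, `0` and `-t`, the last because `J² = -1`; the factor `1/4`
normalises the sum. -/
theorem tensorTrace_traceTensor {e : Module.Basis (Fin 6) ℝ L} {J : L →ₗ[ℝ] L}
    (hJ : J ∈ almostComplex e) (t : Module.Dual ℝ L) (Z : L) :
    tensorTrace e (traceTensor e J t) Z = t Z := by
  have h1 := sum_metric_basis_mul e t Z
  have h2 := sum_metric_basis_mul e (t.comp J) (J Z)
  simp only [LinearMap.comp_apply, hJ.1, map_neg] at h2
  have h3 : ∑ i, metric e (e i) (e i) * t Z = 6 * t Z := by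
    simp [metric_self_basis]
  simp only [tensorTrace, traceTensor_apply, metric_apply_J_self hJ, ← Finset.mul_sum,
    Finset.sum_add_distrib, Finset.sum_sub_distrib, h1, h2, h3]
  simp
  ring

theorem traceTensor_mem_ghSpace {e : Module.Basis (Fin 6) ℝ L} {J : L →ₗ[ℝ] L}
    (hJ : J ∈ almostComplex e) (t : Module.Dual ℝ L) : traceTensor e J t ∈ ghSpace J := by
  intro X Y Z
  simp only [traceTensor_apply, hJ.1, map_neg]
  constructor <;> ring

theorem traceTensor_invariant {e : Module.Basis (Fin 6) ℝ L} {J : L →ₗ[ℝ] L}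
    (hJ : J ∈ almostComplex e) (t : Module.Dual ℝ L) (X Y Z : L) :
    traceTensor e J t X Y Z = traceTensor e J t (J X) (J Y) Z := by
  simp only [traceTensor_apply, hJ.1, map_neg, metric_skew hJ]
  ring

/-- The trace as a linear form. -/
def traceForm (e : Module.Basis (Fin 6) ℝ L) (a : L →ₗ[ℝ] L →ₗ[ℝ] L →ₗ[ℝ] ℝ) :
    Module.Dual ℝ L :=
  ∑ i, a (e i) (e i)

theorem traceForm_apply (e : Module.Basis (Fin 6) ℝ L) (a : L →ₗ[ℝ] L →ₗ[ℝ] L →ₗ[ℝ] ℝ)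
    (Z : L) : traceForm e a Z = tensorTrace e a Z := by
  simp [traceForm, tensorTrace]

/-- `𝒲₃ ⊕ 𝒲₄` consists of the tensors in `𝒲` with `a(X, Y, Z) = a(JX, JY, Z)`. -/
theorem mem_ghW3_sup_ghW4_iff {e : Module.Basis (Fin 6) ℝ L} {J : L →ₗ[ℝ] L}
    (hJ : J ∈ almostComplex e) (a : L →ₗ[ℝ] L →ₗ[ℝ] L →ₗ[ℝ] ℝ) :
    a ∈ ghW3 e J ⊔ ghW4 e J ↔ a ∈ ghSpace J ∧ ∀ X Y Z, a X Y Z = a (J X) (J Y) Z := by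
  constructor
  · intro h
    obtain ⟨b, hb, c, hc, rfl⟩ := Submodule.mem_sup.1 h
    refine ⟨add_mem hb.1 hc.1, fun X Y Z => ?_⟩
    -- An element of `𝒲₄` is recovered from its trace, so it inherits the `J`-invariance of
    -- `traceTensor`.
    have hc' : c = traceTensor e J (traceForm e c) := by
      ext X Y Z
      rw [traceTensor_apply]
      simp only [traceForm_apply]
      exact hc.2 X Y Z
    have h1 := hb.2.1 X Y Z
    have h2 := traceTensor_invariant hJ (traceForm e c) X Y Z
    rw [← hc'] at h2
    simp only [LinearMap.add_apply, h1, h2]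
  · rintro ⟨h1, h2⟩
    -- `b` is the `𝒲₄` component of `a`; it has the same trace, so `a - b` is trace-free.
    set b := traceTensor e J (traceForm e a) with hb
    have tb : ∀ Z, tensorTrace e b Z = tensorTrace e a Z := fun Z => by
      rw [hb, tensorTrace_traceTensor hJ, traceForm_apply]
    have hbW : b ∈ ghSpace J := traceTensor_mem_ghSpace hJ _
    refine Submodule.mem_sup.2 ⟨a + (-1 : ℝ) • b,
      ⟨add_mem h1 (Submodule.smul_mem _ _ hbW), ?_, ?_⟩, b, ⟨hbW, ?_⟩, ?_⟩
    · intro X Y Z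
      simp only [LinearMap.add_apply, LinearMap.smul_apply]
      rw [h2 X Y Z, hb, traceTensor_invariant hJ _ X Y Z]
    · intro Z
      rw [tensorTrace_add, tensorTrace_smul, tb]
      ring
    · intro X Y Z
      simp only [tb]
      rw [hb, traceTensor_apply]
      simp only [traceForm_apply]
    · ext X Y Z
      simp

/-- `𝒵₃₄` is the set of invariant Hermitian structures. -/
theorem classZ34_eq_hermitianStructures (e : Module.Basis (Fin 6) ℝ L) :
    classZ34 e = hermitianStructures e := by
  ext J
  refine and_congr_right fun hJ => ?_
  rw [mem_ghW3_sup_ghW4_iff hJ, nijenhuis_eq_zero_iff hJ]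
  exact and_iff_right (nablaForm_mem_ghSpace hJ)

/-- The cyclic sum of `∇ω` is `dω`. -/
theorem cyclicSum_nablaForm {e : Module.Basis (Fin 6) ℝ L} {J : L →ₗ[ℝ] L}
    (hJ : J ∈ almostComplex e) (X Y Z : L) :
    nablaForm e (fundamentalForm e J) X Y Z + nablaForm e (fundamentalForm e J) Y Z X
      + nablaForm e (fundamentalForm e J) Z X Y = extDerivForm (fundamentalForm e J) X Y Z := by
  have s : ∀ X Y, fundamentalForm e J X Y = -fundamentalForm e J Y X := by
    intro X Y
    change metric e (J X) Y = -metric e (J Y) X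
    rw [metric_skew hJ, metric_comm]
  have n : ∀ X Y Z, nablaForm e (fundamentalForm e J) X Y Z =
    -fundamentalForm e J (leviCivita e X Y) Z - fundamentalForm e J Y (leviCivita e X Z) :=
    fun _ _ _ => rfl
  simp only [n, extDerivForm, ← leviCivita_torsionFree e, map_sub, LinearMap.sub_apply]
  rw [s Y, s Z, s X]
  ring

/-- `𝒵₂` is the set of invariant symplectic structures compatible with the metric. -/
theorem classZ2_eq_symplecticStructures (e : Module.Basis (Fin 6) ℝ L) :
    classZ2 e = symplecticStructures e := by
  ext J
  refine and_congr_right fun hJ => ?_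
  simp only [← cyclicSum_nablaForm hJ]
  exact and_iff_right (nablaForm_mem_ghSpace hJ)

end General

/-! ### Almost complex structures and their coefficient matrices -/

section General

variable {L : Type*} [LieRing L] [LieAlgebra ℝ L]

theorem fundamentalForm_basis (e : Module.Basis (Fin 6) ℝ L) (J : L →ₗ[ℝ] L) (i j : Fin 6) :
    fundamentalForm e J (e i) (e j) = e.coord j (J (e i)) :=
  metric_self_basis e _ j

/-- This fixes the convention used below: `J` acts on row vectors by right multiplication with the
matrix of `ω`. -/
theorem coord_J (e : Module.Basis (Fin 6) ℝ L) (J : L →ₗ[ℝ] L) (X : L) (k : Fin 6) :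
    e.coord k (J X) = ∑ i, e.coord i X * fundamentalForm e J (e i) (e k) := by
  conv_lhs => rw [← e.sum_repr X]
  simp only [map_sum, map_smul, smul_eq_mul, fundamentalForm_basis, Module.Basis.coord_apply]

theorem fundamentalForm_injective (e : Module.Basis (Fin 6) ℝ L) :
    Function.Injective (fundamentalForm e) := by
  intro J K h
  refine e.ext fun i => e.ext_elem fun j => ?_
  have := fundamentalForm_basis e J i j
  rw [h, fundamentalForm_basis] at this
  exact this.symm

theorem fundamentalForm_skew {e : Module.Basis (Fin 6) ℝ L} {J : L →ₗ[ℝ] L}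
    (hJ : J ∈ almostComplex e) (i j : Fin 6) :
    fundamentalForm e J (e i) (e j) = -fundamentalForm e J (e j) (e i) := by
  change metric e (J (e i)) (e j) = -metric e (J (e j)) (e i)
  rw [metric_skew hJ, metric_comm]

theorem fundamentalForm_sq {e : Module.Basis (Fin 6) ℝ L} {J : L →ₗ[ℝ] L}
    (hJ : J ∈ almostComplex e) (i k : Fin 6) :
    ∑ j, fundamentalForm e J (e i) (e j) * fundamentalForm e J (e j) (e k) =
      if i = k then -1 else 0 := by
  have h := coord_J e J (J (e i)) k
  rw [hJ.1] at h
  simp only [fundamentalForm_basis] at h ⊢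
  rw [← h]
  simp only [map_neg, Module.Basis.coord_apply, Module.Basis.repr_self, Finsupp.single_apply]
  split_ifs <;> simp

/-- `J` is `ω` with an index raised; orthogonality follows from skewness together with `J² = -1`. -/
theorem exists_almostComplex {e : Module.Basis (Fin 6) ℝ L} {ω : LinearMap.BilinForm ℝ L}
    (skew : ∀ i j, ω (e i) (e j) = -ω (e j) (e i))
    (sq : ∀ i k, ∑ j, ω (e i) (e j) * ω (e j) (e k) = if i = k then -1 else 0)
    (pf : 0 < pfaffian e ω) : ∃ J ∈ almostComplex e, fundamentalForm e J = ω := by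
  let J : L →ₗ[ℝ] L := e.constr ℝ fun i => ∑ j, ω (e i) (e j) • e j
  have hJe : ∀ i, J (e i) = ∑ j, ω (e i) (e j) • e j := fun i => by simp [J]
  have hω : fundamentalForm e J = ω := by
    refine e.ext fun i => e.ext fun j => ?_
    rw [fundamentalForm_basis, hJe]
    simp [Finsupp.single_apply]
  have hJJ : ∀ X, J (J X) = -X := by
    intro X
    have : J ∘ₗ J = -LinearMap.id := by
      refine e.ext fun i => e.ext_elem fun k => ?_
      have h := coord_J e J (J (e i)) k
      simp only [← fundamentalForm_basis, hω, sq] at h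
      simp only [LinearMap.comp_apply, LinearMap.neg_apply, LinearMap.id_apply, map_neg,
        Finsupp.neg_apply, Module.Basis.repr_self, Finsupp.single_apply]
      rw [← Module.Basis.coord_apply, h]
      split_ifs <;> simp
    exact LinearMap.congr_fun this X
  have hsk : ∀ X Y, metric e (J X) Y = -metric e X (J Y) := by
    have : (metric e).compLeft J = -(metric e).compRight J := by
      refine e.ext fun i => e.ext fun j => ?_
      change fundamentalForm e J (e i) (e j) = -metric e (e i) (J (e j))
      rw [metric_comm e (e i)]
      change fundamentalForm e J (e i) (e j) = -fundamentalForm e J (e j) (e i)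
      rw [hω, skew]
    exact fun X Y => LinearMap.congr_fun₂ this X Y
  refine ⟨J, ⟨hJJ, fun X Y => ?_, hω.symm ▸ pf⟩, hω⟩
  rw [hsk, hJJ, map_neg, neg_neg]

end General

/-! ### Solving for the coefficients of `ω` on `𝔤₂` -/

/-- The bracket of `𝔤₂` in coordinates. -/
def bracketCoord (x y : Fin 6 → ℝ) : Fin 6 → ℝ :=
  ![0, 0, 0, 0, x 1 * y 0 - x 0 * y 1, x 3 * y 0 - x 0 * y 3 + x 2 * y 1 - x 1 * y 2]

theorem coord_bracket (X Y : g2) (i : Fin 6) :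
    g2Basis.coord i ⁅X, Y⁆ = bracketCoord (g2Basis.coord · X) (g2Basis.coord · Y) i :=
  congrFun (g2_bracket X Y) i

/-- The Nijenhuis tensor of `𝔤₂` in coordinates. -/
def nijenhuisCoord (M : Fin 6 → Fin 6 → ℝ) (x y : Fin 6 → ℝ) (k : Fin 6) : ℝ :=
  bracketCoord (fun j => ∑ i, x i * M i j) (fun j => ∑ i, y i * M i j) k - bracketCoord x y k
    - ∑ i, bracketCoord (fun j => ∑ i, x i * M i j) y i * M i k
    - ∑ i, bracketCoord x (fun j => ∑ i, y i * M i j) i * M i k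

theorem coord_nijenhuis (J : g2 →ₗ[ℝ] g2) (X Y : g2) (k : Fin 6) :
    g2Basis.coord k (nijenhuis J X Y) =
      nijenhuisCoord (fun i j => fundamentalForm g2Basis J (g2Basis i) (g2Basis j))
        (g2Basis.coord · X) (g2Basis.coord · Y) k := by
  simp only [nijenhuis, map_sub, coord_J g2Basis J, coord_bracket, nijenhuisCoord]

theorem eq_zero_of_sum_sq_eq_zero {a b c d : ℝ} (h : a ^ 2 + b ^ 2 + c ^ 2 + d ^ 2 = 0) :
    a = 0 ∧ b = 0 ∧ c = 0 ∧ d = 0 := by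
  have ha := sq_nonneg a
  have hb := sq_nonneg b
  have hc := sq_nonneg c
  have hd := sq_nonneg d
  refine ⟨?_, ?_, ?_, ?_⟩ <;> refine (pow_eq_zero_iff two_ne_zero).1 ?_ <;> linarith

/-- An integrable orthogonal almost complex structure preserves the centre `⟨e₅, e₆⟩`. -/
theorem center_invariant {M : Fin 6 → Fin 6 → ℝ} (skew : ∀ i j, M i j = -M j i)
    (sq : ∀ i k, ∑ j, M i j * M j k = if i = k then -1 else 0)
    (N : ∀ x y k, nijenhuisCoord M x y k = 0) :
    M 4 5 ^ 2 = 1 ∧ M 0 4 = 0 ∧ M 1 4 = 0 ∧ M 2 4 = 0 ∧ M 3 4 = 0 ∧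
      M 0 5 = 0 ∧ M 1 5 = 0 ∧ M 2 5 = 0 ∧ M 3 5 = 0 := by
  have d : ∀ i, M i i = 0 := fun i => by linarith [skew i i]
  have s44 := sq 4 4
  have s55 := sq 5 5
  have s45 := sq 4 5
  simp only [Fin.sum_univ_six, d, skew 4 0, skew 4 1, skew 4 2, skew 4 3, skew 5 0, skew 5 1,
    skew 5 2, skew 5 3, skew 5 4, if_true, Fin.reduceEq, if_false] at s44 s55 s45
  -- As `e₅` is central, `N(e₅, Y) = [Je₅, JY] - J[Je₅, Y]`, and the first bracket has no component
  -- along `e₁, …, e₄`. So `J[Je₅, Y]` is central, here for `Y = e₁` and `Y = e₂`.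
  have a0 := N (Pi.single 4 1) (Pi.single 0 1) 0
  have a1 := N (Pi.single 4 1) (Pi.single 0 1) 1
  have a2 := N (Pi.single 4 1) (Pi.single 0 1) 2
  have a3 := N (Pi.single 4 1) (Pi.single 0 1) 3
  have b0 := N (Pi.single 4 1) (Pi.single 1 1) 0
  have b1 := N (Pi.single 4 1) (Pi.single 1 1) 1
  have b2 := N (Pi.single 4 1) (Pi.single 1 1) 2
  have b3 := N (Pi.single 4 1) (Pi.single 1 1) 3
  clear N sq
  simp [nijenhuisCoord, bracketCoord, Fin.sum_univ_six, skew 4 0, skew 4 1, skew 4 2, skew 4 3,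
    skew 5 0, skew 5 1, skew 5 2, skew 5 3, d] at a0 a1 a2 a3 b0 b1 b2 b3
  -- Let `u`, `v` be columns `4`, `5` of `M` restricted to rows `0` to `3`. By `M² = -1` they are
  -- orthogonal with squared norm `1 - M 4 5 ^ 2`. The relations obtained are `M 1 4 u + M 3 4 v =
  -- 0` and `M 0 4 u - M 2 4 v = 0`; pairing them with `u` and `v` kills every entry of `u` times
  -- that norm.
  have e1 : M 1 4 * (1 - M 4 5 ^ 2) = 0 := by
    linear_combination M 1 4 * s44 + M 3 4 * s45
      - M 0 4 * a0 - M 1 4 * a1 - M 2 4 * a2 - M 3 4 * a3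
  have e3 : M 3 4 * (1 - M 4 5 ^ 2) = 0 := by
    linear_combination M 3 4 * s55 + M 1 4 * s45
      - M 0 5 * a0 - M 1 5 * a1 - M 2 5 * a2 - M 3 5 * a3
  have e0 : M 0 4 * (1 - M 4 5 ^ 2) = 0 := by
    linear_combination M 0 4 * s44 - M 2 4 * s45
      + M 0 4 * b0 + M 1 4 * b1 + M 2 4 * b2 + M 3 4 * b3
  have e2 : M 2 4 * (1 - M 4 5 ^ 2) = 0 := by
    linear_combination M 2 4 * s55 - M 0 4 * s45
      - M 0 5 * b0 - M 1 5 * b1 - M 2 5 * b2 - M 3 5 * b3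
  have key : (1 - M 4 5 ^ 2) ^ 2 = 0 := by
    linear_combination (1 - M 4 5 ^ 2) * s44 + M 0 4 * e0 + M 1 4 * e1 + M 2 4 * e2 + M 3 4 * e3
  have hs : M 4 5 ^ 2 = 1 := by linarith [pow_eq_zero_iff (two_ne_zero) |>.1 key]
  clear a0 a1 a2 a3 b0 b1 b2 b3 e0 e1 e2 e3 key
  obtain ⟨h04, h14, h24, h34⟩ := eq_zero_of_sum_sq_eq_zero
    (a := M 0 4) (b := M 1 4) (c := M 2 4) (d := M 3 4) (by linarith)
  obtain ⟨h05, h15, h25, h35⟩ := eq_zero_of_sum_sq_eq_zero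
    (a := M 0 5) (b := M 1 5) (c := M 2 5) (d := M 3 5) (by linarith)
  exact ⟨hs, h04, h14, h24, h34, h05, h15, h25, h35⟩

/-- A skew-symmetric orthogonal `4 × 4` matrix is self-dual or anti-self-dual. -/
theorem selfDual_of_sq {a b c d f g s : ℝ} (hs : s ^ 2 = 1)
    (h00 : a ^ 2 + b ^ 2 + c ^ 2 = 1) (h11 : a ^ 2 + d ^ 2 + f ^ 2 = 1)
    (h22 : b ^ 2 + d ^ 2 + g ^ 2 = 1) (h33 : c ^ 2 + f ^ 2 + g ^ 2 = 1)
    (h01 : b * d + c * f = 0) (h02 : a * d - c * g = 0) (h03 : a * f + b * g = 0)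
    (pf : 0 < s * (a * g - b * f + c * d)) : g = s * a ∧ f = -s * b ∧ d = s * c := by
  -- The squared Pfaffian of a skew orthogonal matrix is its determinant, hence `1`; positivity then
  -- gives `s * Pf = 1`.
  have hp : (a * g - b * f + c * d) ^ 2 = 1 := by
    have e1 : g ^ 2 = a ^ 2 := by linarith
    have e2 : f ^ 2 = b ^ 2 := by linarith
    have e3 : d ^ 2 = c ^ 2 := by linarith
    have : (a * g - b * f + c * d) ^ 2 = (a ^ 2 + b ^ 2 + c ^ 2) ^ 2 := by
      linear_combination a ^ 2 * e1 + b ^ 2 * e2 + c ^ 2 * e3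
        - 2 * b * g * h03 + 2 * b ^ 2 * e1 + 2 * c * g * h02 + 2 * c ^ 2 * e1
        - 2 * c * f * h01 + 2 * c ^ 2 * e2
    rw [this, h00, one_pow]
  have hps : s * (a * g - b * f + c * d) = 1 := by
    have : (s * (a * g - b * f + c * d)) ^ 2 = 1 := by rw [mul_pow, hs, hp, one_mul]
    nlinarith
  -- Expanded, this is `1 + 1 - 2 s Pf`.
  have sum : (g - s * a) ^ 2 + (f + s * b) ^ 2 + (d - s * c) ^ 2 = 0 := by
    linear_combination (-1/2) * h00 + (1/2) * (h11 + h22 + h33) - 2 * hps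
      + (a ^ 2 + b ^ 2 + c ^ 2) * hs + h00
  refine ⟨?_, ?_, ?_⟩ <;> nlinarith [sq_nonneg (g - s * a), sq_nonneg (f + s * b),
    sq_nonneg (d - s * c)]

/-- A closed element of `𝒵` is determined by its coefficients `A = ω(e₁, e₆)`, `B = -ω(e₂, e₆)`. -/
theorem symplectic_coefficients {M : Fin 6 → Fin 6 → ℝ} (skew : ∀ i j, M i j = -M j i)
    (sq : ∀ i k, ∑ j, M i j * M j k = if i = k then -1 else 0)
    (pf : 0 < -(M 0 2 * (M 1 5 * M 3 4)) + M 0 3 * (M 1 5 * M 2 4) - M 0 4 * (M 1 5 * M 2 3)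
      + M 0 5 * (M 1 2 * M 3 4 - M 1 3 * M 2 4 + M 1 4 * M 2 3))
    (h45 : M 4 5 = 0) (h25 : M 2 5 = 0) (h35 : M 3 5 = 0)
    (h24 : M 2 4 = -M 0 5) (h34 : M 3 4 = M 1 5) :
    M 0 5 ^ 2 + M 1 5 ^ 2 = 1 ∧ M 0 4 = 0 ∧ M 1 4 = 0 ∧ M 0 1 = 0 ∧ M 2 3 = 0 ∧
      M 0 2 = -M 1 5 ^ 2 ∧ M 0 3 = -(M 0 5 * M 1 5) ∧ M 1 2 = M 0 5 * M 1 5 ∧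
      M 1 3 = M 0 5 ^ 2 := by
  have d : ∀ i, M i i = 0 := fun i => by linarith [skew i i]
  have s44 := sq 4 4
  have s55 := sq 5 5
  have s00 := sq 0 0
  have s11 := sq 1 1
  have s50 := sq 5 0
  have s51 := sq 5 1
  have s52 := sq 5 2
  have s53 := sq 5 3
  have s40 := sq 4 0
  have s41 := sq 4 1
  have s42 := sq 4 2
  have s43 := sq 4 3
  simp [Fin.sum_univ_six, d, skew 1 0, skew 2 0, skew 2 1, skew 3 0, skew 3 1, skew 3 2,
    skew 4 0, skew 4 1, skew 4 2, skew 4 3, skew 5 0, skew 5 1, skew 5 2, skew 5 3, skew 5 4,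
    h45, h25, h35, h24, h34] at s44 s55 s00 s11 s50 s51 s52 s53 s40 s41 s42 s43
  rw [h24, h34] at pf
  -- Row `5` has unit length. Closedness puts the same two numbers, up to sign, in row `4`, which
  -- leaves no room for `M 0 4` and `M 1 4`.
  have hAB : M 0 5 ^ 2 + M 1 5 ^ 2 = 1 := by linarith
  obtain ⟨h04, h14, -, -⟩ := eq_zero_of_sum_sq_eq_zero
    (a := M 0 4) (b := M 1 4) (c := 0) (d := 0) (by linarith)
  simp only [h04, h14] at pf s00 s11 s40 s41 s42 s43
  clear sq skew d
  generalize M 0 5 = A, M 1 5 = B, M 0 1 = m01, M 0 2 = m02, M 0 3 = m03, M 1 2 = m12,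
    M 1 3 = m13, M 2 3 = m23 at *
  -- `t` is `-ω(p, q)` for `p = B e₁ - A e₂` and `q = B e₃ + A e₄`, which span the complement of
  -- `⟨e₅, e₆, Je₅, Je₆⟩`. It is also the quantity in `pf`, so orientation selects `t = 1`. Here `B`
  -- is `M 1 5`, the opposite of the parameter in `circleForm`.
  obtain ⟨t, ht⟩ : ∃ t, t = -(B ^ 2 * m02) - A * B * m03 + A * B * m12 + A ^ 2 * m13 := ⟨_, rfl⟩
  have e01 : m01 = 0 := by grind
  have e23 : m23 = 0 := by grind
  have e02 : m02 = -B ^ 2 * t := by grind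
  have e03 : m03 = -(A * B * t) := by grind
  have e12 : m12 = A * B * t := by grind
  have e13 : m13 = A ^ 2 * t := by grind
  have htt : t ^ 2 = 1 := by grind
  have ht0 : 0 < t := by linarith
  have ht1 : t = 1 := by nlinarith
  rw [ht1] at e02 e03 e12 e13
  refine ⟨hAB, h04, h14, e01, e23, ?_, ?_, ?_, ?_⟩ <;> linarith

/-- The coefficients of an integrable element of `𝒵`. -/
theorem hermitian_coefficients {M : Fin 6 → Fin 6 → ℝ} (skew : ∀ i j, M i j = -M j i)
    (sq : ∀ i k, ∑ j, M i j * M j k = if i = k then -1 else 0)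
    (pf : 0 < M 4 5 * (M 0 1 * M 2 3 - M 0 2 * M 1 3 + M 0 3 * M 1 2))
    (hc : M 4 5 ^ 2 = 1 ∧ M 0 4 = 0 ∧ M 1 4 = 0 ∧ M 2 4 = 0 ∧ M 3 4 = 0 ∧
      M 0 5 = 0 ∧ M 1 5 = 0 ∧ M 2 5 = 0 ∧ M 3 5 = 0)
    (N : ∀ x y k, nijenhuisCoord M x y k = 0) :
    (M 4 5 = -1 ∧ M 0 2 = 0 ∧ M 0 3 = 0 ∧ M 1 2 = 0 ∧ M 1 3 = 0 ∧ M 2 3 = -M 0 1 ∧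
      (M 0 1 = 1 ∨ M 0 1 = -1)) ∨
    (M 4 5 = 1 ∧ M 0 1 = 0 ∧ M 2 3 = 0 ∧ M 0 2 = -1 / 2 ∧ M 1 3 = 1 / 2 ∧ M 1 2 = M 0 3 ∧
      (M 0 3 = √3 / 2 ∨ M 0 3 = -(√3 / 2))) := by
  obtain ⟨hs, h04, h14, h24, h34, h05, h15, h25, h35⟩ := hc
  have d : ∀ i, M i i = 0 := fun i => by linarith [skew i i]
  have s00 := sq 0 0
  have s11 := sq 1 1
  have s22 := sq 2 2
  have s33 := sq 3 3
  have s01 := sq 0 1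
  have s02 := sq 0 2
  have s03 := sq 0 3
  simp [Fin.sum_univ_six, d, skew 1 0, skew 2 0, skew 2 1, skew 3 0, skew 3 1, skew 3 2, h04,
    h14, h24, h34, h05, h15, h25, h35] at s00 s11 s22 s33 s01 s02 s03
  obtain ⟨hg, hf, hd⟩ := selfDual_of_sq hs (a := M 0 1) (b := M 0 2) (c := M 0 3) (d := M 1 2)
    (f := M 1 3) (g := M 2 3) (by linarith) (by linarith) (by linarith) (by linarith)
    (by linarith) (by linarith) (by linarith) pf
  clear pf s11 s22 s33 s01 s02 s03
  have a4 := N (Pi.single 0 1) (Pi.single 1 1) 4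
  have a5 := N (Pi.single 0 1) (Pi.single 1 1) 5
  have b4 := N (Pi.single 0 1) (Pi.single 2 1) 4
  have b5 := N (Pi.single 0 1) (Pi.single 2 1) 5
  clear N
  simp [nijenhuisCoord, bracketCoord, Fin.sum_univ_six, skew 1 0, skew 2 0, skew 2 1, skew 3 0,
    skew 3 1, skew 3 2, skew 4 0, skew 4 1, skew 4 2, skew 4 3, skew 5 0, skew 5 1,
    skew 5 2, skew 5 3, skew 5 4, d, h04, h14, h24, h34, h05, h15, h25, h35, hg, hf, hd]
    at a4 a5 b4 b5
  have hs2 : M 4 5 = 1 ∨ M 4 5 = -1 := by simpa using hs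
  rcases hs2 with h | h
  · right
    rw [h] at a4 a5 b4 b5 hg hf hd
    have hx : M 0 1 = 0 := by
      -- The second factor cannot vanish, since `M 0 2` is an entry of a unit row.
      have h1 : M 0 1 * (M 0 2 + 2) = 0 := by linear_combination -b4
      refine (mul_eq_zero.1 h1).resolve_right fun h2 => ?_
      nlinarith [mul_self_nonneg (M 0 1), mul_self_nonneg (M 0 3)]
    rw [hx] at a4 s00 hg
    have hy : M 0 2 = -1 / 2 := by linarith
    rw [hy] at s00 hf
    have hz : (M 0 3 - √3 / 2) * (M 0 3 + √3 / 2) = 0 := by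
      have := Real.sq_sqrt (show (0 : ℝ) ≤ 3 by norm_num)
      linear_combination -s00 - this / 4
    refine ⟨h, hx, by linarith, hy, by linarith, by linarith, ?_⟩
    rcases mul_eq_zero.1 hz with h | h
    · left; linarith
    · right; linarith
  · left
    rw [h] at a4 hg hf hd
    -- In the anti-self-dual case `M 0 1` already exhausts the unit length of row `0`.
    have hx : (M 0 1 - 1) * (M 0 1 + 1) = 0 := by linear_combination -a4
    have hx2 : M 0 1 * M 0 1 = 1 := by linear_combination hx
    obtain ⟨hy, hz, -, -⟩ := eq_zero_of_sum_sq_eq_zero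
      (a := M 0 2) (b := M 0 3) (c := 0) (d := 0) (by linarith)
    refine ⟨h, hy, hz, by rw [hd, hz]; ring, by rw [hf, hy]; ring, by rw [hg]; ring, ?_⟩
    rcases mul_eq_zero.1 hx with h | h
    · left; linarith
    · right; linarith

/-! ### Explicit coefficient matrices -/

section General

variable {L : Type*} [LieRing L] [LieAlgebra ℝ L]

/-- The coefficients of `s (e¹² - e³⁴) - e⁵⁶`. -/
def omegaMatrix (s : ℝ) : Matrix (Fin 6) (Fin 6) ℝ :=
  !![0, s, 0, 0, 0, 0;
    -s, 0, 0, 0, 0, 0;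
    0, 0, 0, -s, 0, 0;
    0, 0, s, 0, 0, 0;
    0, 0, 0, 0, 0, -1;
    0, 0, 0, 0, 1, 0]

/-- The coefficients of `e⁵⁶ + c (e¹³ + e⁴²) + d (e¹⁴ + e²³)`. -/
def epsilonMatrix (c d : ℝ) : Matrix (Fin 6) (Fin 6) ℝ :=
  !![0, 0, c, d, 0, 0;
    0, 0, d, -c, 0, 0;
    -c, -d, 0, 0, 0, 0;
    -d, c, 0, 0, 0, 0;
    0, 0, 0, 0, 0, 1;
    0, 0, 0, 0, -1, 0]

/-- The coefficients of `circleForm e A B`. -/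
def circleMatrix (A B : ℝ) : Matrix (Fin 6) (Fin 6) ℝ :=
  !![0, 0, -(B * B), B * A, 0, A;
    0, 0, -(A * B), A * A, 0, -B;
    B * B, A * B, 0, 0, -A, 0;
    -(B * A), -(A * A), 0, 0, -B, 0;
    0, 0, A, B, 0, 0;
    -A, B, 0, 0, 0, 0]

theorem form_basis (e : Module.Basis (Fin 6) ℝ L) (i j k l : Fin 6) :
    form e i j (e k) (e l) = (if k = i then 1 else 0) * (if l = j then 1 else 0)
      - (if k = j then 1 else 0) * (if l = i then 1 else 0) := by
  simp only [form, wedge, LinearMap.sub_apply, LinearMap.BilinForm.linMulLin_apply,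
    Module.Basis.coord_apply, Module.Basis.repr_self, Finsupp.single_apply]

theorem toMatrix_omega1 (e : Module.Basis (Fin 6) ℝ L) :
    LinearMap.BilinForm.toMatrix e (omega1 e) = omegaMatrix 1 := by
  ext i j
  rw [LinearMap.BilinForm.toMatrix_apply]
  simp only [omega1, LinearMap.sub_apply, form_basis]
  fin_cases i <;> fin_cases j <;> simp [omegaMatrix]

theorem toMatrix_omega2 (e : Module.Basis (Fin 6) ℝ L) :
    LinearMap.BilinForm.toMatrix e (omega2 e) = omegaMatrix (-1) := by
  ext i j
  rw [LinearMap.BilinForm.toMatrix_apply]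
  simp only [omega2, LinearMap.sub_apply, LinearMap.add_apply, LinearMap.neg_apply, form_basis]
  fin_cases i <;> fin_cases j <;> simp [omegaMatrix]

theorem toMatrix_epsilonForm (e : Module.Basis (Fin 6) ℝ L) (θ : ℝ) :
    LinearMap.BilinForm.toMatrix e (epsilonForm e θ) =
      epsilonMatrix (Real.cos θ) (Real.sin θ) := by
  ext i j
  rw [LinearMap.BilinForm.toMatrix_apply]
  simp only [epsilonForm, LinearMap.smul_apply, LinearMap.add_apply, smul_eq_mul, form_basis]
  fin_cases i <;> fin_cases j <;> simp [epsilonMatrix]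

theorem toMatrix_circleForm (e : Module.Basis (Fin 6) ℝ L) (A B : ℝ) :
    LinearMap.BilinForm.toMatrix e (circleForm e A B) = circleMatrix A B := by
  ext i j
  rw [LinearMap.BilinForm.toMatrix_apply]
  simp only [circleForm, wedge, LinearMap.sub_apply, LinearMap.add_apply, LinearMap.neg_apply,
    LinearMap.BilinForm.linMulLin_apply, LinearMap.smul_apply, smul_eq_mul,
    Module.Basis.coord_apply, Module.Basis.repr_self, Finsupp.single_apply]
  fin_cases i <;> fin_cases j <;> simp [circleMatrix, mul_comm]

/-- The Pfaffian of a `6 × 6` matrix, computed from the entries above the diagonal. -/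
def matrixPfaffian (M : Matrix (Fin 6) (Fin 6) ℝ) : ℝ :=
  M 0 1 * (M 2 3 * M 4 5 - M 2 4 * M 3 5 + M 2 5 * M 3 4)
    - M 0 2 * (M 1 3 * M 4 5 - M 1 4 * M 3 5 + M 1 5 * M 3 4)
    + M 0 3 * (M 1 2 * M 4 5 - M 1 4 * M 2 5 + M 1 5 * M 2 4)
    - M 0 4 * (M 1 2 * M 3 5 - M 1 3 * M 2 5 + M 1 5 * M 2 3)
    + M 0 5 * (M 1 2 * M 3 4 - M 1 3 * M 2 4 + M 1 4 * M 2 3)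

theorem pfaffian_eq (e : Module.Basis (Fin 6) ℝ L) (ω : LinearMap.BilinForm ℝ L) :
    pfaffian e ω = matrixPfaffian (LinearMap.BilinForm.toMatrix e ω) := by
  simp only [pfaffian, halfSquare, matrixPfaffian, LinearMap.BilinForm.toMatrix_apply]

theorem exists_almostComplex_of_matrix {e : Module.Basis (Fin 6) ℝ L}
    {ω : LinearMap.BilinForm ℝ L} {M : Matrix (Fin 6) (Fin 6) ℝ}
    (h : LinearMap.BilinForm.toMatrix e ω = M) (skew : M.transpose = -M) (sq : M * M = -1)
    (pf : 0 < matrixPfaffian M) : ∃ J ∈ almostComplex e, fundamentalForm e J = ω := by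
  have hω : ∀ i j, ω (e i) (e j) = M i j := fun i j => by
    rw [← h, LinearMap.BilinForm.toMatrix_apply]
  refine exists_almostComplex (fun i j => ?_) (fun i k => ?_) (by rwa [pfaffian_eq, h])
  · rw [hω, hω]
    exact congrFun (congrFun skew j) i
  · simp only [hω]
    have := congrFun (congrFun sq i) k
    rw [Matrix.mul_apply] at this
    rw [this, Matrix.neg_apply, Matrix.one_apply]
    split_ifs <;> simp

theorem omegaMatrix_transpose (s : ℝ) : (omegaMatrix s).transpose = -omegaMatrix s := by
  ext i j
  fin_cases i <;> fin_cases j <;> simp [omegaMatrix]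

theorem epsilonMatrix_transpose (c d : ℝ) :
    (epsilonMatrix c d).transpose = -epsilonMatrix c d := by
  ext i j
  fin_cases i <;> fin_cases j <;> simp [epsilonMatrix]

theorem circleMatrix_transpose (A B : ℝ) :
    (circleMatrix A B).transpose = -circleMatrix A B := by
  ext i j
  fin_cases i <;> fin_cases j <;> simp [circleMatrix]

theorem omegaMatrix_sq {s : ℝ} (hs : s ^ 2 = 1) : omegaMatrix s * omegaMatrix s = -1 := by
  ext i j
  rw [Matrix.mul_apply, Fin.sum_univ_six]
  fin_cases i <;> fin_cases j <;> simp [omegaMatrix] <;> linarith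

theorem epsilonMatrix_sq {c d : ℝ} (h : c ^ 2 + d ^ 2 = 1) :
    epsilonMatrix c d * epsilonMatrix c d = -1 := by
  ext i j
  rw [Matrix.mul_apply, Fin.sum_univ_six]
  fin_cases i <;> fin_cases j <;> simp [epsilonMatrix] <;> linarith

theorem circleMatrix_sq {A B : ℝ} (h : A ^ 2 + B ^ 2 = 1) :
    circleMatrix A B * circleMatrix A B = -1 := by
  ext i j
  rw [Matrix.mul_apply, Fin.sum_univ_six]
  fin_cases i <;> fin_cases j <;> simp [circleMatrix] <;> grind

theorem matrixPfaffian_omegaMatrix (s : ℝ) : matrixPfaffian (omegaMatrix s) = s ^ 2 := by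
  simp [matrixPfaffian, omegaMatrix]
  ring

theorem matrixPfaffian_epsilonMatrix (c d : ℝ) :
    matrixPfaffian (epsilonMatrix c d) = c ^ 2 + d ^ 2 := by
  simp [matrixPfaffian, epsilonMatrix]
  ring

theorem matrixPfaffian_circleMatrix (A B : ℝ) :
    matrixPfaffian (circleMatrix A B) = (A ^ 2 + B ^ 2) ^ 2 := by
  simp [matrixPfaffian, circleMatrix]
  ring

theorem toMatrix_fundamentalForm_skew {e : Module.Basis (Fin 6) ℝ L} {J : L →ₗ[ℝ] L}
    (hJ : J ∈ almostComplex e) (i j : Fin 6) :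
    LinearMap.BilinForm.toMatrix e (fundamentalForm e J) i j =
      -LinearMap.BilinForm.toMatrix e (fundamentalForm e J) j i := by
  simpa only [LinearMap.BilinForm.toMatrix_apply] using fundamentalForm_skew hJ i j

theorem toMatrix_fundamentalForm_sq {e : Module.Basis (Fin 6) ℝ L} {J : L →ₗ[ℝ] L}
    (hJ : J ∈ almostComplex e) (i k : Fin 6) :
    ∑ j, LinearMap.BilinForm.toMatrix e (fundamentalForm e J) i j *
      LinearMap.BilinForm.toMatrix e (fundamentalForm e J) j k = if i = k then -1 else 0 := by
  simpa only [LinearMap.BilinForm.toMatrix_apply] using fundamentalForm_sq hJ i k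

/-- Skew-symmetric matrices are determined by their entries above the diagonal. -/
theorem eq_of_upper_eq {M N : Matrix (Fin 6) (Fin 6) ℝ} (hM : ∀ i j, M i j = -M j i)
    (hN : N.transpose = -N) (h : ∀ i j, i < j → M i j = N i j) : M = N := by
  have hN' : ∀ i j, N i j = -N j i := fun i j => congrFun (congrFun hN j) i
  ext i j
  rcases lt_trichotomy i j with hij | rfl | hij
  · exact h i j hij
  · linarith [hM i i, hN' i i]
  · rw [hM, hN', h j i hij]

end General

/-! ### The Hermitian structures -/

theorem nijenhuisCoord_omegaMatrix {s : ℝ} (hs : s ^ 2 = 1) (x y : Fin 6 → ℝ) (k : Fin 6) :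
    nijenhuisCoord (omegaMatrix s) x y k = 0 := by
  fin_cases k <;> simp [nijenhuisCoord, bracketCoord, omegaMatrix, Fin.sum_univ_six] <;> grind

/-- Only `d²` is prescribed, so both angles `±2π/3` are covered at once. -/
theorem nijenhuisCoord_epsilonMatrix {d : ℝ} (hd : d ^ 2 = 3 / 4) (x y : Fin 6 → ℝ)
    (k : Fin 6) : nijenhuisCoord (epsilonMatrix (-1 / 2) d) x y k = 0 := by
  fin_cases k <;> simp [nijenhuisCoord, bracketCoord, epsilonMatrix, Fin.sum_univ_six] <;> grind

theorem nijenhuis_eq_zero_iff_coord (J : g2 →ₗ[ℝ] g2) : (∀ X Y, nijenhuis J X Y = 0) ↔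
    ∀ x y k, nijenhuisCoord
      (LinearMap.BilinForm.toMatrix g2Basis (fundamentalForm g2Basis J)) x y k = 0 := by
  have hM : (LinearMap.BilinForm.toMatrix g2Basis (fundamentalForm g2Basis J) :
      Fin 6 → Fin 6 → ℝ) =
      fun i j => fundamentalForm g2Basis J (g2Basis i) (g2Basis j) := by
    ext i j
    exact LinearMap.BilinForm.toMatrix_apply _ _ _ _
  rw [hM]
  constructor
  · intro h x y k
    -- Coordinate vectors serve directly as elements of `g2`, which is definitionally `ℝ⁶` with its
    -- standard basis.
    exact (coord_nijenhuis J x y k).symm.trans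
      ((congrArg (g2Basis.coord k) (h x y)).trans (map_zero _))
  · intro h X Y
    refine g2Basis.ext_elem fun k => ?_
    rw [← Module.Basis.coord_apply, coord_nijenhuis, h, map_zero]
    rfl

theorem cos_two_pi_div_three : Real.cos (2 * Real.pi / 3) = -1 / 2 := by
  rw [show 2 * Real.pi / 3 = Real.pi - Real.pi / 3 by ring, Real.cos_pi_sub,
    Real.cos_pi_div_three]
  norm_num

theorem sin_two_pi_div_three : Real.sin (2 * Real.pi / 3) = √3 / 2 := by
  rw [show 2 * Real.pi / 3 = Real.pi - Real.pi / 3 by ring, Real.sin_pi_sub,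
    Real.sin_pi_div_three]

theorem sqrt_three_div_two_sq : (√3 / 2) ^ 2 = (3 / 4 : ℝ) := by
  rw [div_pow, Real.sq_sqrt (by norm_num)]
  norm_num

theorem toMatrix_epsilon_pos {L : Type*} [LieRing L] [LieAlgebra ℝ L]
    (e : Module.Basis (Fin 6) ℝ L) :
    LinearMap.BilinForm.toMatrix e (epsilonForm e (2 * Real.pi / 3)) =
      epsilonMatrix (-1 / 2) (√3 / 2) := by
  rw [toMatrix_epsilonForm, cos_two_pi_div_three, sin_two_pi_div_three]

theorem toMatrix_epsilon_neg {L : Type*} [LieRing L] [LieAlgebra ℝ L]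
    (e : Module.Basis (Fin 6) ℝ L) :
    LinearMap.BilinForm.toMatrix e (epsilonForm e (-(2 * Real.pi / 3))) =
      epsilonMatrix (-1 / 2) (-(√3 / 2)) := by
  rw [toMatrix_epsilonForm, Real.cos_neg, Real.sin_neg, cos_two_pi_div_three,
    sin_two_pi_div_three]

theorem mem_image_hermitian {ω : LinearMap.BilinForm ℝ g2} {M : Matrix (Fin 6) (Fin 6) ℝ}
    (h : LinearMap.BilinForm.toMatrix g2Basis ω = M) (skew : M.transpose = -M)
    (sq : M * M = -1) (pf : 0 < matrixPfaffian M) (N : ∀ x y k, nijenhuisCoord M x y k = 0) :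
    ω ∈ fundamentalForm g2Basis '' hermitianStructures g2Basis := by
  obtain ⟨J, hJ, rfl⟩ := exists_almostComplex_of_matrix h skew sq pf
  refine ⟨J, ⟨hJ, (nijenhuis_eq_zero_iff_coord J).2 ?_⟩, rfl⟩
  rwa [h]

/-- The invariant Hermitian structures on `(M₂, g)`. -/
theorem image_hermitianStructures :
    fundamentalForm g2Basis '' hermitianStructures g2Basis =
      {omega1 g2Basis, omega2 g2Basis,
        epsilonForm g2Basis (2 * Real.pi / 3), epsilonForm g2Basis (-(2 * Real.pi / 3))} := by
  apply Set.Subset.antisymm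
  · rintro _ ⟨J, ⟨hJ, hN⟩, rfl⟩
    have inj := (LinearMap.BilinForm.toMatrix (R₁ := ℝ) g2Basis).injective
    have skew := toMatrix_fundamentalForm_skew hJ
    have sq := toMatrix_fundamentalForm_sq hJ
    have pf := hJ.2.2
    rw [nijenhuis_eq_zero_iff_coord] at hN
    rw [pfaffian_eq, matrixPfaffian] at pf
    have hc := center_invariant skew sq hN
    have hpf := hc
    obtain ⟨h1, h04, h14, h24, h34, h05, h15, h25, h35⟩ := hpf
    rw [h04, h05, h14, h15, h24, h25, h34, h35] at pf
    -- With the centre split off, the Pfaffian factors as `M 4 5` times that of the `4 × 4` block.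
    have key := hermitian_coefficients skew sq (by linarith) hc hN
    simp only [Set.mem_insert_iff, Set.mem_singleton_iff]
    rcases key with ⟨h45, h02, h03, h12, h13, h23, h | h⟩ | ⟨h45, h01, h23, h02, h13, h12, h | h⟩
    · left
      refine inj (Eq.trans ?_ (toMatrix_omega1 _).symm)
      refine eq_of_upper_eq skew (omegaMatrix_transpose _) fun i j hij => ?_
      rw [h] at h23
      fin_cases i <;> fin_cases j <;> first | (exfalso; revert hij; decide) | skip
      all_goals simp [omegaMatrix, h, h02, h03, h12, h13, h23, h45, h04, h14, h24, h34, h05,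
        h15, h25, h35]
    · right; left
      refine inj (Eq.trans ?_ (toMatrix_omega2 _).symm)
      refine eq_of_upper_eq skew (omegaMatrix_transpose _) fun i j hij => ?_
      rw [h] at h23
      fin_cases i <;> fin_cases j <;> first | (exfalso; revert hij; decide) | skip
      all_goals simp [omegaMatrix, h, h02, h03, h12, h13, h23, h45, h04, h14, h24, h34, h05,
        h15, h25, h35]
    · right; right; left
      refine inj (Eq.trans ?_ (toMatrix_epsilon_pos _).symm)
      refine eq_of_upper_eq skew (epsilonMatrix_transpose _ _) fun i j hij => ?_
      rw [h] at h12
      fin_cases i <;> fin_cases j <;>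
        first | (exfalso; revert hij; decide) | skip
      all_goals simp [epsilonMatrix, h, h01, h02, h12, h13, h23, h45, h04, h14, h24, h34, h05,
        h15, h25, h35]
      norm_num
    · right; right; right
      refine inj (Eq.trans ?_ (toMatrix_epsilon_neg _).symm)
      refine eq_of_upper_eq skew (epsilonMatrix_transpose _ _) fun i j hij => ?_
      rw [h] at h12
      fin_cases i <;> fin_cases j <;>
        first | (exfalso; revert hij; decide) | skip
      all_goals simp [epsilonMatrix, h, h01, h02, h12, h13, h23, h45, h04, h14, h24, h34, h05,
        h15, h25, h35]
      norm_num
  · have hs := sqrt_three_div_two_sq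
    rintro _ (rfl | rfl | rfl | rfl)
    · exact mem_image_hermitian (toMatrix_omega1 _) (omegaMatrix_transpose _)
        (omegaMatrix_sq (by norm_num)) (by rw [matrixPfaffian_omegaMatrix]; norm_num)
        (nijenhuisCoord_omegaMatrix (by norm_num))
    · exact mem_image_hermitian (toMatrix_omega2 _) (omegaMatrix_transpose _)
        (omegaMatrix_sq (by norm_num)) (by rw [matrixPfaffian_omegaMatrix]; norm_num)
        (nijenhuisCoord_omegaMatrix (by norm_num))
    · exact mem_image_hermitian (toMatrix_epsilon_pos _) (epsilonMatrix_transpose _ _)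
        (epsilonMatrix_sq (by rw [hs]; norm_num))
        (by rw [matrixPfaffian_epsilonMatrix, hs]; norm_num) (nijenhuisCoord_epsilonMatrix hs)
    · exact mem_image_hermitian (toMatrix_epsilon_neg _) (epsilonMatrix_transpose _ _)
        (epsilonMatrix_sq (by rw [neg_sq, hs]; norm_num))
        (by rw [matrixPfaffian_epsilonMatrix, neg_sq, hs]; norm_num)
        (nijenhuisCoord_epsilonMatrix (by rw [neg_sq, hs]))

/-! ### The symplectic structures -/

/-- The exterior derivative of a 2-form on `𝔤₂` in coordinates. -/
def extDerivCoord (M : Fin 6 → Fin 6 → ℝ) (x y z : Fin 6 → ℝ) : ℝ :=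
  -(∑ k, z k * (bracketCoord x y 4 * M 4 k + bracketCoord x y 5 * M 5 k))
    + ∑ k, y k * (bracketCoord x z 4 * M 4 k + bracketCoord x z 5 * M 5 k)
    - ∑ k, x k * (bracketCoord y z 4 * M 4 k + bracketCoord y z 5 * M 5 k)

/-- Brackets lie in `⟨e₅, e₆⟩`, so only rows `4` and `5` of the matrix of `ω` enter `dω`. -/
theorem apply_bracket (ω : LinearMap.BilinForm ℝ g2) (X Y Z : g2) :
    ω ⁅X, Y⁆ Z = ∑ k, g2Basis.coord k Z *
      (bracketCoord (g2Basis.coord · X) (g2Basis.coord · Y) 4 *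
          LinearMap.BilinForm.toMatrix g2Basis ω 4 k
        + bracketCoord (g2Basis.coord · X) (g2Basis.coord · Y) 5 *
          LinearMap.BilinForm.toMatrix g2Basis ω 5 k) := by
  have hb : ∀ V : g2, ω ⁅X, Y⁆ V =
      bracketCoord (g2Basis.coord · X) (g2Basis.coord · Y) 4 * ω (g2Basis 4) V
        + bracketCoord (g2Basis.coord · X) (g2Basis.coord · Y) 5 * ω (g2Basis 5) V := by
    intro V
    conv_lhs => rw [← g2Basis.sum_repr ⁅X, Y⁆]
    simp only [← Module.Basis.coord_apply, coord_bracket, Fin.sum_univ_six]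
    simp [bracketCoord]
  conv_lhs => rw [← g2Basis.sum_repr Z]
  simp only [map_sum, map_smul, smul_eq_mul, hb, LinearMap.BilinForm.toMatrix_apply,
    Module.Basis.coord_apply, Finset.mul_sum, ← Finset.sum_add_distrib]
  exact Finset.sum_congr rfl fun k _ => by ring

theorem extDerivForm_eq_zero_iff_coord (ω : LinearMap.BilinForm ℝ g2) :
    (∀ X Y Z, extDerivForm ω X Y Z = 0) ↔
      ∀ x y z, extDerivCoord (LinearMap.BilinForm.toMatrix g2Basis ω) x y z = 0 := by
  have key : ∀ X Y Z : g2, extDerivForm ω X Y Z =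
      extDerivCoord (LinearMap.BilinForm.toMatrix g2Basis ω)
        (g2Basis.coord · X) (g2Basis.coord · Y) (g2Basis.coord · Z) := by
    intro X Y Z
    simp only [extDerivForm, extDerivCoord, apply_bracket]
  exact ⟨fun h x y z => (key x y z).symm.trans (h x y z), fun h X Y Z => (key X Y Z).trans (h _ _ _)⟩

theorem extDerivCoord_circleMatrix (A B : ℝ) (x y z : Fin 6 → ℝ) :
    extDerivCoord (circleMatrix A B) x y z = 0 := by
  simp [extDerivCoord, bracketCoord, circleMatrix, Fin.sum_univ_six]
  ring

/-- The coefficients of a closed 2-form on `𝔤₂`. -/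
theorem closed_coefficients {M : Fin 6 → Fin 6 → ℝ} (skew : ∀ i j, M i j = -M j i)
    (h : ∀ x y z, extDerivCoord M x y z = 0) :
    M 4 5 = 0 ∧ M 2 5 = 0 ∧ M 3 5 = 0 ∧ M 2 4 = -M 0 5 ∧ M 3 4 = M 1 5 := by
  -- Each of these five triples yields exactly one of the five linear relations.
  have h015 := h (Pi.single 0 1) (Pi.single 1 1) (Pi.single 5 1)
  have h012 := h (Pi.single 0 1) (Pi.single 1 1) (Pi.single 2 1)
  have h013 := h (Pi.single 0 1) (Pi.single 1 1) (Pi.single 3 1)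
  have h023 := h (Pi.single 0 1) (Pi.single 2 1) (Pi.single 3 1)
  have h123 := h (Pi.single 1 1) (Pi.single 2 1) (Pi.single 3 1)
  clear h
  simp [extDerivCoord, bracketCoord, Fin.sum_univ_six, skew 4 0, skew 4 1, skew 4 2, skew 4 3,
    skew 5 0, skew 5 1, skew 5 2, skew 5 3] at h015 h012 h013 h023 h123
  refine ⟨?_, ?_, ?_, ?_, ?_⟩ <;> linarith

/-- The invariant symplectic structures on `M₂` compatible with `g`. -/
theorem image_symplecticStructures :
    fundamentalForm g2Basis '' symplecticStructures g2Basis = circleS g2Basis := by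
  apply Set.Subset.antisymm
  · rintro _ ⟨J, ⟨hJ, hd⟩, rfl⟩
    have skew := toMatrix_fundamentalForm_skew hJ
    have sq := toMatrix_fundamentalForm_sq hJ
    have pf := hJ.2.2
    rw [extDerivForm_eq_zero_iff_coord] at hd
    rw [pfaffian_eq, matrixPfaffian] at pf
    obtain ⟨h45, h25, h35, h24, h34⟩ := closed_coefficients skew hd
    rw [h45, h25, h35] at pf
    have key := symplectic_coefficients skew sq ?_ h45 h25 h35 h24 h34
    · obtain ⟨hAB, h04, h14, h01, h23, h02, h03, h12, h13⟩ := key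
      refine ⟨LinearMap.BilinForm.toMatrix g2Basis (fundamentalForm g2Basis J) 0 5,
        -LinearMap.BilinForm.toMatrix g2Basis (fundamentalForm g2Basis J) 1 5, by rwa [neg_sq], ?_⟩
      refine (LinearMap.BilinForm.toMatrix (R₁ := ℝ) g2Basis).injective
        (Eq.trans ?_ (toMatrix_circleForm _ _ _).symm)
      refine eq_of_upper_eq skew (circleMatrix_transpose _ _) fun i j hij => ?_
      fin_cases i <;> fin_cases j <;> first | (exfalso; revert hij; decide) | skip
      all_goals simp [circleMatrix, h45, h25, h35, h24, h34, h04, h14, h01, h23, h02, h03, h12, h13]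
      all_goals ring
    · linarith
  · rintro _ ⟨A, B, hAB, rfl⟩
    obtain ⟨J, hJ, h⟩ := exists_almostComplex_of_matrix (toMatrix_circleForm g2Basis A B)
      (circleMatrix_transpose A B) (circleMatrix_sq hAB)
      (by rw [matrixPfaffian_circleMatrix, hAB]; norm_num)
    refine ⟨J, ⟨hJ, ?_⟩, h⟩
    rw [extDerivForm_eq_zero_iff_coord, h, toMatrix_circleForm]
    exact extDerivCoord_circleMatrix A B

/-! ### The circle `𝒮`, the edge `ℰ₀₃` and its equator -/

section General

variable {L : Type*} [LieRing L] [LieAlgebra ℝ L]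

/-- The parametrization of `𝒮` by the unit circle is a topological embedding. -/
theorem isEmbedding_circleForm (e : Module.Basis (Fin 6) ℝ L) :
    Topology.IsEmbedding (fun z : Circle =>
      LinearMap.BilinForm.toMatrix e (circleForm e (z : ℂ).re (z : ℂ).im)) := by
  simp only [toMatrix_circleForm]
  have re : Continuous fun z : Circle => (z : ℂ).re :=
    Complex.continuous_re.comp continuous_subtype_val
  have im : Continuous fun z : Circle => (z : ℂ).im :=
    Complex.continuous_im.comp continuous_subtype_val
  -- The circle is compact and the matrix space Hausdorff, so continuity and injectivity suffice;
  -- entries `(0, 5)` and `(1, 5)` recover `A` and `-B`.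
  refine (Continuous.isClosedEmbedding ?_ ?_).isEmbedding
  · refine continuous_matrix fun i j => ?_
    fin_cases i <;> fin_cases j <;> simp [circleMatrix] <;> fun_prop
  · intro z w h
    have h1 := congrFun (congrFun h 0) 5
    have h2 := congrFun (congrFun h 2) 5
    have h3 := congrFun (congrFun h 1) 5
    simp [circleMatrix] at h1 h2 h3
    exact Circle.ext (Complex.ext h1 h3)

theorem lambdaTwoD_apply (e : Module.Basis (Fin 6) ℝ L) {τ : LinearMap.BilinForm ℝ L}
    (hτ : τ ∈ lambdaTwoD e) : τ (e 4) (e 5) = 0 := by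
  induction hτ using Submodule.span_induction with
  | mem τ h =>
    obtain ⟨i, j, hi, hj, rfl⟩ := h
    have hi' : (4 : Fin 6) ≠ i := hi.ne'
    have hj' : (4 : Fin 6) ≠ j := hj.ne'
    rw [form_basis, if_neg hi', if_neg hj']
    ring
  | zero => rfl
  | add σ τ _ _ hσ hτ => rw [LinearMap.add_apply, LinearMap.add_apply, hσ, hτ, add_zero]
  | smul c τ _ hτ => rw [LinearMap.smul_apply, LinearMap.smul_apply, hτ, smul_zero]

/-- The `e⁵⁶` coefficient is what keeps `ω₁` and `ω₂`, where it is `-1`, off the edge. -/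
theorem apply_of_mem_edge03 {e : Module.Basis (Fin 6) ℝ L} {ω : LinearMap.BilinForm ℝ L}
    (hω : ω ∈ edge03 e) : ω (e 4) (e 5) = 1 := by
  obtain ⟨-, τ, hτ, rfl⟩ := hω
  rw [LinearMap.add_apply, LinearMap.add_apply, lambdaTwoD_apply e hτ, form_basis]
  simp

theorem omega1_notMem_edge03 (e : Module.Basis (Fin 6) ℝ L) : omega1 e ∉ edge03 e := by
  intro h
  have h1 := apply_of_mem_edge03 h
  rw [← LinearMap.BilinForm.toMatrix_apply, toMatrix_omega1] at h1
  simp [omegaMatrix] at h1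
  norm_num at h1

theorem omega2_notMem_edge03 (e : Module.Basis (Fin 6) ℝ L) : omega2 e ∉ edge03 e := by
  intro h
  have h1 := apply_of_mem_edge03 h
  rw [← LinearMap.BilinForm.toMatrix_apply, toMatrix_omega2] at h1
  simp [omegaMatrix] at h1
  norm_num at h1

/-- `ω₀ - ω₃ = 2(e¹² + e³⁴)` is orthogonal to `ε(θ)`, whence equidistance. -/
theorem epsilonForm_mem_equator03 {e : Module.Basis (Fin 6) ℝ L} (θ : ℝ) :
    epsilonForm e θ ∈ equator03 e := by
  refine ⟨⟨?_, Real.cos θ • (form e 0 2 + form e 3 1) + Real.sin θ • (form e 0 3 + form e 1 2),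
    ?_, ?_⟩, ?_⟩
  · obtain ⟨J, hJ, h⟩ := exists_almostComplex_of_matrix (toMatrix_epsilonForm e θ)
      (epsilonMatrix_transpose _ _) (epsilonMatrix_sq (Real.cos_sq_add_sin_sq θ))
      (by rw [matrixPfaffian_epsilonMatrix, Real.cos_sq_add_sin_sq]; norm_num)
    exact ⟨J, hJ, h⟩
  · have hf : ∀ i j : Fin 6, i < 4 → j < 4 → form e i j ∈ lambdaTwoD e :=
      fun i j hi hj => Submodule.subset_span ⟨i, j, hi, hj, rfl⟩
    exact add_mem
      (Submodule.smul_mem _ _ (add_mem (hf _ _ (by decide) (by decide)) (hf _ _ (by decide) (by decide))))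
      (Submodule.smul_mem _ _ (add_mem (hf _ _ (by decide) (by decide)) (hf _ _ (by decide) (by decide))))
  · rw [epsilonForm, add_assoc]
  · have hω : ∀ i j, epsilonForm e θ (e i) (e j) =
        epsilonMatrix (Real.cos θ) (Real.sin θ) i j := fun i j => by
      rw [← toMatrix_epsilonForm e, LinearMap.BilinForm.toMatrix_apply]
    simp only [formInner, hω, Fin.sum_univ_six]
    simp [epsilonMatrix, omega0, omega3, form_basis]

/-- The four invariant Hermitian structures are distinct. -/
theorem ncard_hermitianForms (e : Module.Basis (Fin 6) ℝ L) :
    ({omega1 e, omega2 e, epsilonForm e (2 * Real.pi / 3),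
      epsilonForm e (-(2 * Real.pi / 3))} : Set (LinearMap.BilinForm ℝ L)).ncard = 4 := by
  have sep : ∀ {σ τ : LinearMap.BilinForm ℝ L} {M N : Matrix (Fin 6) (Fin 6) ℝ} (i j : Fin 6),
      LinearMap.BilinForm.toMatrix e σ = M → LinearMap.BilinForm.toMatrix e τ = N →
      M i j ≠ N i j → σ ≠ τ := by
    rintro σ τ _ _ i j rfl rfl h rfl
    exact h rfl
  have h12 := sep 0 1 (toMatrix_omega1 e) (toMatrix_omega2 e) (by simp [omegaMatrix]; norm_num)
  have h13 := sep 0 1 (toMatrix_omega1 e) (toMatrix_epsilon_pos e)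
    (by simp [omegaMatrix, epsilonMatrix])
  have h14 := sep 0 1 (toMatrix_omega1 e) (toMatrix_epsilon_neg e)
    (by simp [omegaMatrix, epsilonMatrix])
  have h23 := sep 0 1 (toMatrix_omega2 e) (toMatrix_epsilon_pos e)
    (by simp [omegaMatrix, epsilonMatrix])
  have h24 := sep 0 1 (toMatrix_omega2 e) (toMatrix_epsilon_neg e)
    (by simp [omegaMatrix, epsilonMatrix])
  have h34 := sep 0 3 (toMatrix_epsilon_pos e) (toMatrix_epsilon_neg e) (by
    have : 0 < √(3 : ℝ) := by positivity
    simp only [epsilonMatrix]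
    simp
    intro h
    linarith)
  rw [Set.ncard_insert_of_notMem (by simp [h12, h13, h14]),
    Set.ncard_insert_of_notMem (by simp [h23, h24]), Set.ncard_pair h34]

end General

end InvariantHermitian

end

theorem corollary2 :
    -- `𝒵₃₄` is the set of invariant Hermitian structures, and consists of exactly four points
    classZ34 g2Basis = hermitianStructures g2Basis ∧
    fundamentalForm g2Basis '' classZ34 g2Basis =
      {omega1 g2Basis, omega2 g2Basis,
        epsilonForm g2Basis (2 * Real.pi / 3), epsilonForm g2Basis (-(2 * Real.pi / 3))} ∧
    (classZ34 g2Basis).ncard = 4 ∧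
    -- exactly two of them lie on the circle `S₀₃`
    (fundamentalForm g2Basis '' classZ34 g2Basis) ∩ equator03 g2Basis =
      {epsilonForm g2Basis (2 * Real.pi / 3), epsilonForm g2Basis (-(2 * Real.pi / 3))} ∧
    -- `𝒵₂` is the set of compatible symplectic structures, and is `𝒮`
    classZ2 g2Basis = symplecticStructures g2Basis ∧
    fundamentalForm g2Basis '' classZ2 g2Basis = circleS g2Basis ∧
    -- `𝒮` is a circle: its parametrization by `A + iB` in the unit circle is an embedding into the
    -- space of coefficient matrices of 2-forms
    Topology.IsEmbedding (fun z : Circle =>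
      LinearMap.BilinForm.toMatrix g2Basis (circleForm g2Basis (z : ℂ).re (z : ℂ).im)) := by
  rw [classZ34_eq_hermitianStructures, classZ2_eq_symplecticStructures,
    image_symplecticStructures]
  refine ⟨rfl, image_hermitianStructures, ?_, ?_, rfl, rfl, isEmbedding_circleForm g2Basis⟩
  -- Structures are counted through their fundamental forms, since `J ↦ ω` is injective.
  · rw [← Set.ncard_image_of_injective _ (fundamentalForm_injective g2Basis),
      image_hermitianStructures, ncard_hermitianForms]
  · rw [image_hermitianStructures]
    apply Set.Subset.antisymm
    · rintro _ ⟨rfl | rfl | h, h'⟩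
      · exact absurd h'.1 (omega1_notMem_edge03 _)
      · exact absurd h'.1 (omega2_notMem_edge03 _)
      · exact h
    · rintro _ (rfl | rfl)
      · exact ⟨by simp, epsilonForm_mem_equator03 _⟩
      · exact ⟨by simp, epsilonForm_mem_equator03 _⟩
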